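/- Let $\alpha>-\tfrac12$ and write uniquely $\alpha=k+r$ with $k\in\mathbb N=\{0,1,2,\dots\}$ and $-\tfrac12<r\le\tfrac12$. Functions take values in a fixed field $\mathbb K\in\{\mathbb R,\mathbb C\}$; put $\mathbb R^*=\mathbb R\setminus\{0\}$ and $\frac{d}{dx^2}=\frac1{2x}\frac{d}{dx}$. For $a\ge 0$ let $\mathcal D_a(\mathbb R)$ be the space of $C^\infty$ functions on $\mathbb R$ supported in $[-a,a]$ (with the topology of uniform convergence of all derivatives), and $\mathcal D(\mathbb R)=\bigcup_{a\ge0}\mathcal D_a(\mathbb R)$ with the (locally convex) inductive limit topology. The Weyl integral of $f\in\mathcal D(\mathbb R)$ is $$W_\alpha f(y)=\frac{2\Gamma(\alpha+1)}{\sqrt\pi\,\Gamma(\alpha+\frac12)}\int_{|y|}^{\infty}(x^2-y^2)^{\alpha-\frac12}\,x\,f(\operatorname{sgn}(y)x)\,dx,\qquad y\in\mathbb R^* .$$ Let $\mathcal K_0$ be the space of $C^\infty$ functions $f$ on $\mathbb R^*$ with bounded support such that for all $n\in\mathbb N$ the limits of $y^nf^{(n)}(y)$ as $y\to0^+$ and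 as $y\to0^-$ exist. For $f\in\mathcal K_0$ define, for $x\in\mathbb R^*$, $$V_\alpha f(x)=(-1)^{k+1}\frac{2^{2k+1}k!}{(2k+1)!}\Big(\frac{d}{dx^2}\Big)^{k+1}f(x)\quad\text{if }\alpha=k+\tfrac12,$$ $$V_\alpha f(x)=\frac{(-1)^{k+1}2\sqrt\pi}{\Gamma(\alpha+1)\Gamma(\frac12-r)}\int_{|x|}^\infty(y^2-x^2)^{-r-\frac12}\Big[\Big(\frac{d}{dx^2}\Big)^{k+1}f\Big](\operatorname{sgn}(x)y)\,y\,dy\quad\text{if }\alpha=k+r,\ |r|<\tfrac12,$$ and $$Q_\alpha f(x)=\Big(\frac{d}{dx^2}\Big)^{k+1}f(x)\quad\text{if }\alpha=k+\tfrac12,\qquad Q_\alpha f(x)=|x|^{1-2r}\int_1^\infty(t^2-1)^{-r-\frac12}\Big[\Big(\frac{d}{dx^2}\Big)^{k+1}f\Big](xt)\,t\,dt\quad\text{if }|r|<\tfrac12 .$$ For $a\ge0$ let $\Delta_{a,\alpha}(\mathbb R)$ be the space of all $f\in\mathcal K_0$ with support in $[-a,a]$ such that $Q_\alpha f$ extends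 to a function in $\mathcal D(\mathbb R)$, with the topology defined by the seminorms $f\mapsto\sup\{|(Q_\alpha f)^{(p)}(x)| : 0\le p\le n,\ x\in[-a,a]\setminus\{0\}\}$, $n\in\mathbb N$, and let $\Delta_\alpha(\mathbb R)=\bigcup_{a\ge0}\Delta_{a,\alpha}(\mathbb R)$ with the (locally convex) inductive limit topology. Then for every $a\ge0$ the operator $W_\alpha$ is a topological isomorphism (a linear homeomorphism) from $\mathcal D_a(\mathbb R)$ onto $\Delta_{a,\alpha}(\mathbb R)$, whose inverse is the restriction of $V_\alpha$ to $\Delta_{a,\alpha}(\mathbb R)$; and $W_\alpha$ is a topological isomorphism from $\mathcal D(\mathbb R)$ onto $\Delta_\alpha(\mathbb R)$, whose inverse is the restriction of $V_\alpha$ to $\Delta_\alpha(\mathbb R)$. (Here $V_\alpha g$, defined on $\mathbb R^*$, is identified with its continuous extension to $\mathbb R$.) -/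

import Mathlib

open Real Set Filter Topology MeasureTheory
open scoped ContDiff Distributions

noncomputable section

namespace BesselStruve

variable {𝕜 : Type*} [RCLike 𝕜]

/-! Functions on `ℝ* = ℝ \ {0}` are represented by functions on `ℝ`, and only their values at
nonzero points are used; where uniqueness of the representative matters (elements of `K₀`), the
representative is normalised to vanish at `0`. Functions take values in `𝕜 = ℝ` or `𝕜 = ℂ`. -/

/-- The operator `d/dx² = (1/(2x)) d/dx`. -/
def dSq (f : ℝ → 𝕜) : ℝ → 𝕜 := fun x => (1 / (2 * x)) • deriv f x

/-- The nonnegative integer `k` such that `α = k + r` with `-1/2 < r ≤ 1/2` (for `α > -1/2`);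
see `ord_half` and `ord_frac`. -/
def ord (α : ℝ) : ℕ := ⌈α - 1 / 2⌉₊

/-- The number `r = α - k`, `-1/2 < r ≤ 1/2` (for `α > -1/2`). -/
def frac (α : ℝ) : ℝ := α - ord α

/-- The Weyl integral `W_α f (y)`, for `y ≠ 0`. -/
def weylW (α : ℝ) (f : ℝ → 𝕜) (y : ℝ) : 𝕜 :=
  (2 * Gamma (α + 1) / (√π * Gamma (α + 1 / 2))) •
    ∫ x in Ioi |y|, ((x ^ 2 - y ^ 2) ^ (α - 1 / 2) * x) • f (Real.sign y * x)

open Classical in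
/-- The operator `V_α`, `V_α f (x)` for `x ≠ 0`. The first branch is the case
`α = k + 1/2`, the second one the case `α = k + r` with `-1/2 < r < 1/2`;
see `weylV_half` and `weylV_frac`. -/
def weylV (α : ℝ) (f : ℝ → 𝕜) (x : ℝ) : 𝕜 :=
  if α = ord α + 1 / 2 then
    ((-1) ^ (ord α + 1) * (2 ^ (2 * ord α + 1) * (Nat.factorial (ord α) : ℝ) / (Nat.factorial (2 * ord α + 1) : ℝ))) •
      dSq^[ord α + 1] f x
  else
    ((-1) ^ (ord α + 1) * (2 * √π) / (Gamma (α + 1) * Gamma (1 / 2 - frac α))) •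
      ∫ y in Ioi |x|, ((y ^ 2 - x ^ 2) ^ (-frac α - 1 / 2) * y) •
        dSq^[ord α + 1] f (Real.sign x * y)

open Classical in
/-- The function on `ℝ*` whose extendability to a test function defines `Δ_{a,α}` and whose
derivatives define the seminorms of `Δ_{a,α}`: for `α = k + 1/2` it is `(d/dx²)^{k+1} f`, and for
`α = k + r`, `|r| < 1/2`, it is
`|x|^{1-2r} ∫_1^∞ (t²-1)^{-r-1/2} ((d/dx²)^{k+1} f)(xt) t dt`. -/
def core (α : ℝ) (f : ℝ → 𝕜) (x : ℝ) : 𝕜 :=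
  if α = ord α + 1 / 2 then
    dSq^[ord α + 1] f x
  else
    (|x| ^ (1 - 2 * frac α)) •
      ∫ t in Ioi (1 : ℝ), ((t ^ 2 - 1) ^ (-frac α - 1 / 2) * t) • dSq^[ord α + 1] f (x * t)

/-! ### The order of `α` and the explicit formulas -/

theorem ord_half (k : ℕ) : ord ((k : ℝ) + 1 / 2) = k := by
  simp [ord]

theorem ord_frac (k : ℕ) (r : ℝ) (h₁ : -(1 / 2) < r) (h₂ : r < 1 / 2) :
    ord ((k : ℝ) + r) = k := by
  unfold ord
  rcases Nat.eq_zero_or_pos k with rfl | hk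
  · rw [Nat.ceil_eq_zero]; push_cast; linarith
  · rw [Nat.ceil_eq_iff hk.ne']
    have : ((k - 1 : ℕ) : ℝ) = (k : ℝ) - 1 := by
      rw [Nat.cast_sub hk]; simp
    rw [this]
    constructor <;> linarith

theorem frac_frac (k : ℕ) (r : ℝ) (h₁ : -(1 / 2) < r) (h₂ : r < 1 / 2) :
    frac ((k : ℝ) + r) = r := by
  simp [frac, ord_frac k r h₁ h₂]

theorem frac_lt_half (α : ℝ) (h : α ≠ ord α + 1 / 2) : frac α < 1 / 2 := by
  have h1 : α - 1 / 2 ≤ ord α := Nat.le_ceil _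
  unfold frac
  rcases lt_or_eq_of_le h1 with h2 | h2
  · linarith
  · exact absurd (by linarith) h

/-- `V_α` for `α = k + 1/2`. -/
theorem weylV_half (k : ℕ) (f : ℝ → 𝕜) (x : ℝ) :
    weylV ((k : ℝ) + 1 / 2) f x =
      ((-1) ^ (k + 1) * (2 ^ (2 * k + 1) * (Nat.factorial k : ℝ) / (Nat.factorial (2 * k + 1) : ℝ))) •
        dSq^[k + 1] f x := by
  unfold weylV
  rw [ord_half, if_pos rfl]

/-- `V_α` for `α = k + r`, `-1/2 < r < 1/2`. -/
theorem weylV_frac (k : ℕ) (r : ℝ) (h₁ : -(1 / 2) < r) (h₂ : r < 1 / 2) (f : ℝ → 𝕜) (x : ℝ) :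
    weylV ((k : ℝ) + r) f x =
      ((-1) ^ (k + 1) * (2 * √π) / (Gamma ((k : ℝ) + r + 1) * Gamma (1 / 2 - r))) •
        ∫ y in Ioi |x|, ((y ^ 2 - x ^ 2) ^ (-r - 1 / 2) * y) •
          dSq^[k + 1] f (Real.sign x * y) := by
  unfold weylV
  rw [frac_frac k r h₁ h₂, ord_frac k r h₁ h₂, if_neg (by intro h; linarith)]

theorem core_half (k : ℕ) (f : ℝ → 𝕜) (x : ℝ) :
    core ((k : ℝ) + 1 / 2) f x = dSq^[k + 1] f x := by
  unfold core
  rw [ord_half, if_pos rfl]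

theorem core_frac (k : ℕ) (r : ℝ) (h₁ : -(1 / 2) < r) (h₂ : r < 1 / 2) (f : ℝ → 𝕜) (x : ℝ) :
    core ((k : ℝ) + r) f x = (|x| ^ (1 - 2 * r)) •
      ∫ t in Ioi (1 : ℝ), ((t ^ 2 - 1) ^ (-r - 1 / 2) * t) • dSq^[k + 1] f (x * t) := by
  unfold core
  rw [frac_frac k r h₁ h₂, ord_frac k r h₁ h₂, if_neg (by intro h; linarith)]

/-! ### Elementary facts on `dSq` and `core`, needed for linearity -/

theorem isOpen_punctured : IsOpen ({0}ᶜ : Set ℝ) := isOpen_compl_singleton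

theorem contDiffOn_dSq {f : ℝ → 𝕜} (hf : ContDiffOn ℝ ∞ f {0}ᶜ) :
    ContDiffOn ℝ ∞ (dSq f) {0}ᶜ := by
  have h1 : ContDiffOn ℝ ∞ (fun x : ℝ => 1 / (2 * x)) {0}ᶜ := by
    refine ContDiffOn.div contDiffOn_const (by fun_prop) ?_
    intro x hx
    simpa using hx
  exact h1.smul (hf.deriv_of_isOpen isOpen_punctured le_rfl)

theorem contDiffOn_dSq_iterate {f : ℝ → 𝕜} (hf : ContDiffOn ℝ ∞ f {0}ᶜ) (n : ℕ) :
    ContDiffOn ℝ ∞ (dSq^[n] f) {0}ᶜ := by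
  induction n with
  | zero => exact hf
  | succ n ih => rw [Function.iterate_succ_apply']; exact contDiffOn_dSq ih

theorem dSq_congr {f g : ℝ → 𝕜} (h : EqOn f g {0}ᶜ) : EqOn (dSq f) (dSq g) {0}ᶜ := by
  intro x hx
  have : f =ᶠ[𝓝 x] g := h.eventuallyEq_of_mem (isOpen_punctured.mem_nhds hx)
  simp [dSq, this.deriv_eq]

theorem dSq_iterate_add {f g : ℝ → 𝕜} (hf : ContDiffOn ℝ ∞ f {0}ᶜ)
    (hg : ContDiffOn ℝ ∞ g {0}ᶜ) (n : ℕ) :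
    EqOn (dSq^[n] (f + g)) (dSq^[n] f + dSq^[n] g) {0}ᶜ := by
  induction n with
  | zero => intro x _; rfl
  | succ n ih =>
    simp only [Function.iterate_succ_apply']
    refine (dSq_congr ih).trans ?_
    intro x hx
    have h1 := ((contDiffOn_dSq_iterate hf n).differentiableOn (by simp)).differentiableAt
      (isOpen_punctured.mem_nhds hx)
    have h2 := ((contDiffOn_dSq_iterate hg n).differentiableOn (by simp)).differentiableAt
      (isOpen_punctured.mem_nhds hx)
    simp only [dSq, Pi.add_apply]
    rw [deriv_add h1 h2, smul_add]

theorem dSq_iterate_smul (c : 𝕜) {f : ℝ → 𝕜} (hf : ContDiffOn ℝ ∞ f {0}ᶜ) (n : ℕ) :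
    EqOn (dSq^[n] (c • f)) (c • dSq^[n] f) {0}ᶜ := by
  induction n with
  | zero => intro x _; rfl
  | succ n ih =>
    simp only [Function.iterate_succ_apply']
    refine (dSq_congr ih).trans ?_
    intro x hx
    have h1 := ((contDiffOn_dSq_iterate hf n).differentiableOn (by simp)).differentiableAt
      (isOpen_punctured.mem_nhds hx)
    simp only [dSq, Pi.smul_apply]
    rw [deriv_const_smul c h1, smul_comm]

theorem dSq_iterate_support {f : ℝ → 𝕜} {R : ℝ} (h : ∀ x, R < |x| → f x = 0) (n : ℕ) :
    ∀ x, R < |x| → dSq^[n] f x = 0 := by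
  induction n with
  | zero => exact h
  | succ n ih =>
    intro x hx
    have ho : {y : ℝ | R < |y|} ∈ 𝓝 x := (isOpen_lt continuous_const continuous_abs).mem_nhds hx
    have : dSq^[n] f =ᶠ[𝓝 x] fun _ => (0 : 𝕜) := by
      filter_upwards [ho] with y hy using ih y hy
    rw [Function.iterate_succ_apply']
    simp [dSq, this.deriv_eq]

theorem integrableOn_kernel {h : ℝ → 𝕜} (hc : ContinuousOn h {0}ᶜ) {R : ℝ}
    (hR : ∀ x, R < |x| → h x = 0) {s : ℝ} (hs : -1 < s) {x : ℝ} (hx : x ≠ 0) :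
    IntegrableOn (fun t : ℝ => ((t ^ 2 - 1) ^ s * t) • h (x * t)) (Ioi 1) := by
  set M : ℝ := max 1 (R / |x|) with hM
  have hM1 : 1 ≤ M := le_max_left _ _
  have hx' : 0 < |x| := abs_pos.mpr hx
  rw [← Ioc_union_Ioi_eq_Ioi hM1]
  refine IntegrableOn.union ?_ ?_
  · have h1 : IntegrableOn (fun t : ℝ => (t - 1) ^ s) (Icc 1 M) := by
      have := (intervalIntegral.intervalIntegrable_rpow' (a := 0) (b := M - 1) hs).comp_sub_right 1
      simp only [zero_add, sub_add_cancel] at this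
      rw [intervalIntegrable_iff_integrableOn_Icc_of_le hM1] at this
      exact this
    have h2 : ContinuousOn (fun t : ℝ => ((t + 1) ^ s * t) • h (x * t)) (Icc 1 M) := by
      refine ContinuousOn.smul (ContinuousOn.mul ?_ continuousOn_id) ?_
      · refine ContinuousOn.rpow_const (by fun_prop) ?_
        intro t ht
        left
        have := ht.1
        linarith
      · refine hc.comp (by fun_prop) ?_
        intro t ht
        have := ht.1
        simp only [mem_compl_iff, mem_singleton_iff, mul_eq_zero, not_or]
        exact ⟨hx, by linarith⟩
    have h3 := h1.smul_continuousOn h2 isCompact_Icc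
    refine (h3.congr_fun ?_ measurableSet_Icc).mono_set Ioc_subset_Icc_self
    intro t ht
    have ht1 := ht.1
    have : (t ^ 2 - 1) ^ s = (t - 1) ^ s * (t + 1) ^ s := by
      rw [← Real.mul_rpow (by linarith) (by linarith)]
      congr 1
      ring
    simp only [this, smul_smul, mul_assoc]
  · refine IntegrableOn.congr_fun (f := fun _ => (0 : 𝕜)) integrableOn_zero ?_ measurableSet_Ioi
    intro t ht
    have ht' : M < t := ht
    have ht0 : 0 < t := by linarith
    have : R < |x * t| := by
      rw [abs_mul, abs_of_pos ht0, mul_comm]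
      exact (div_lt_iff₀ hx').mp (lt_of_le_of_lt (le_max_right _ _) ht')
    simp [hR _ this]

theorem core_add (α : ℝ) {f g : ℝ → 𝕜} (hf : ContDiffOn ℝ ∞ f {0}ᶜ)
    (hg : ContDiffOn ℝ ∞ g {0}ᶜ) {R S : ℝ} (hR : ∀ x, R < |x| → f x = 0)
    (hS : ∀ x, S < |x| → g x = 0) {x : ℝ} (hx : x ≠ 0) :
    core α (f + g) x = core α f x + core α g x := by
  unfold core
  split_ifs with h
  · exact dSq_iterate_add hf hg _ hx
  · have hs : -1 < -frac α - 1 / 2 := by linarith [frac_lt_half α h]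
    rw [← smul_add, ← integral_add
      (integrableOn_kernel (contDiffOn_dSq_iterate hf _).continuousOn
        (dSq_iterate_support hR _) hs hx)
      (integrableOn_kernel (contDiffOn_dSq_iterate hg _).continuousOn
        (dSq_iterate_support hS _) hs hx)]
    congr 1
    refine setIntegral_congr_fun measurableSet_Ioi ?_
    intro t ht
    have ht0 : t ≠ 0 := by
      have : (1 : ℝ) < t := ht
      exact (lt_trans one_pos this).ne'
    have := dSq_iterate_add hf hg (ord α + 1) (mul_ne_zero hx ht0)
    simp only [this, Pi.add_apply, smul_add]

theorem core_smul (α : ℝ) (c : 𝕜) {f : ℝ → 𝕜} (hf : ContDiffOn ℝ ∞ f {0}ᶜ) {x : ℝ}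
    (hx : x ≠ 0) : core α (c • f) x = c • core α f x := by
  unfold core
  split_ifs with h
  · exact dSq_iterate_smul c hf _ hx
  · rw [smul_comm c, ← integral_smul c]
    congr 1
    refine setIntegral_congr_fun (measurableSet_Ioi (a := (1 : ℝ))) ?_
    intro t ht
    have ht0 : t ≠ 0 := by
      have : (1 : ℝ) < t := ht
      exact (lt_trans one_pos this).ne'
    have := dSq_iterate_smul c hf (ord α + 1) (mul_ne_zero hx ht0)
    simp only [this, Pi.smul_apply]
    rw [smul_comm]

theorem core_zero (α : ℝ) (x : ℝ) : core α (0 : ℝ → 𝕜) x = 0 := by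
  have h : ∀ n : ℕ, dSq^[n] (0 : ℝ → 𝕜) = 0 := by
    intro n
    induction n with
    | zero => rfl
    | succ n ih =>
      rw [Function.iterate_succ_apply', ih]
      funext y
      simp [dSq]
  simp [core, h]

/-! ### The spaces `K₀`, `Δ_{a,α}` and `Δ_α` -/

variable (𝕜)

/-- The space `K₀` of smooth functions `f` on `ℝ*` with bounded support such that the two one-sided
limits of `yⁿ f⁽ⁿ⁾(y)` at `0` exist for every `n`. -/
def K₀ : Submodule 𝕜 (ℝ → 𝕜) where
  carrier := {f | f 0 = 0 ∧ ContDiffOn ℝ ∞ f {0}ᶜ ∧ (∃ R : ℝ, ∀ x, R < |x| → f x = 0) ∧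
    ∀ n : ℕ, (∃ l, Tendsto (fun y : ℝ => y ^ n • iteratedDeriv n f y) (𝓝[>] 0) (𝓝 l)) ∧
      (∃ l, Tendsto (fun y : ℝ => y ^ n • iteratedDeriv n f y) (𝓝[<] 0) (𝓝 l))}
  zero_mem' := by
    refine ⟨rfl, contDiffOn_const, ⟨0, fun _ _ => rfl⟩, fun n => ?_⟩
    have h : ∀ y : ℝ, iteratedDeriv n (0 : ℝ → 𝕜) y = 0 := by
      intro y
      have : (0 : ℝ → 𝕜) = fun _ => 0 := rfl
      rw [this, iteratedDeriv_const]
      simp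
    simp only [h, smul_zero]
    exact ⟨⟨0, tendsto_const_nhds⟩, ⟨0, tendsto_const_nhds⟩⟩
  add_mem' := by
    rintro f g ⟨hf0, hf, ⟨R, hR⟩, hfl⟩ ⟨hg0, hg, ⟨S, hS⟩, hgl⟩
    refine ⟨by simp [hf0, hg0], hf.add hg, ⟨max R S, fun x hx => ?_⟩, fun n => ?_⟩
    · simp [hR x ((le_max_left _ _).trans_lt hx), hS x ((le_max_right _ _).trans_lt hx)]
    · have key : ∀ y : ℝ, y ≠ 0 → y ^ n • iteratedDeriv n f y + y ^ n • iteratedDeriv n g y =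
          y ^ n • iteratedDeriv n (f + g) y := by
        intro y hy
        have hn : (n : WithTop ℕ∞) ≤ ∞ := by exact_mod_cast le_top
        rw [iteratedDeriv_add ((hf.contDiffAt (isOpen_punctured.mem_nhds hy)).of_le hn)
          ((hg.contDiffAt (isOpen_punctured.mem_nhds hy)).of_le hn), smul_add]
      obtain ⟨⟨l₁, h₁⟩, ⟨l₂, h₂⟩⟩ := hfl n
      obtain ⟨⟨m₁, k₁⟩, ⟨m₂, k₂⟩⟩ := hgl n
      refine ⟨⟨l₁ + m₁, (h₁.add k₁).congr' ?_⟩, ⟨l₂ + m₂, (h₂.add k₂).congr' ?_⟩⟩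
      · filter_upwards [self_mem_nhdsWithin] with y hy using key y (ne_of_gt hy)
      · filter_upwards [self_mem_nhdsWithin] with y hy using key y (ne_of_lt hy)
  smul_mem' := by
    rintro c f ⟨hf0, hf, ⟨R, hR⟩, hfl⟩
    refine ⟨by simp [hf0], hf.const_smul c, ⟨R, fun x hx => by simp [hR x hx]⟩, fun n => ?_⟩
    have key : ∀ y : ℝ, y ≠ 0 → c • (y ^ n • iteratedDeriv n f y) =
        y ^ n • iteratedDeriv n (c • f) y := by
      intro y hy
      have hn : (n : WithTop ℕ∞) ≤ ∞ := by exact_mod_cast le_top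
      rw [iteratedDeriv_const_smul ((hf.contDiffAt (isOpen_punctured.mem_nhds hy)).of_le hn),
        smul_comm]
    obtain ⟨⟨l₁, h₁⟩, ⟨l₂, h₂⟩⟩ := hfl n
    refine ⟨⟨c • l₁, (h₁.const_smul c).congr' ?_⟩, ⟨c • l₂, (h₂.const_smul c).congr' ?_⟩⟩
    · filter_upwards [self_mem_nhdsWithin] with y hy using key y (ne_of_gt hy)
    · filter_upwards [self_mem_nhdsWithin] with y hy using key y (ne_of_lt hy)

/-- The space `Δ_{a,α}` of the functions `f` in `K₀` with support in `[-a, a]` such that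
`core α f` can be extended to a function in `𝓓(ℝ)`. -/
def deltaSubmodule (a α : ℝ) : Submodule 𝕜 (ℝ → 𝕜) where
  carrier := {f | f ∈ K₀ 𝕜 ∧ (∀ x, a < |x| → f x = 0) ∧
    ∃ φ : 𝓓((⊤ : TopologicalSpace.Opens ℝ), 𝕜), ∀ x, x ≠ 0 → core α f x = φ x}
  zero_mem' := ⟨zero_mem _, fun _ _ => rfl, 0, fun x _ => by simp [core_zero]⟩
  add_mem' := by
    rintro f g ⟨hf, hfa, φ, hφ⟩ ⟨hg, hga, ψ, hψ⟩
    refine ⟨add_mem hf hg, fun x hx => by simp [hfa x hx, hga x hx], φ + ψ, fun x hx => ?_⟩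
    rw [core_add α hf.2.1 hg.2.1 hfa hga hx, hφ x hx, hψ x hx]
    rfl
  smul_mem' := by
    rintro c f ⟨hf, hfa, φ, hφ⟩
    refine ⟨Submodule.smul_mem _ c hf, fun x hx => by simp [hfa x hx], c • φ, fun x hx => ?_⟩
    rw [core_smul α c hf.2.1 hx, hφ x hx]
    rfl

theorem deltaSubmodule_mono {a b α : ℝ} (h : a ≤ b) :
    deltaSubmodule 𝕜 a α ≤ deltaSubmodule 𝕜 b α :=
  fun _ hf => ⟨hf.1, fun x hx => hf.2.1 x (lt_of_le_of_lt h hx), hf.2.2⟩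

/-- The space `Δ_{a,α}` as a type; it carries the topology defined by the seminorms
`DeltaIn.seminorm` below (and not the topology of pointwise convergence). -/
def DeltaIn (a α : ℝ) : Type _ := deltaSubmodule 𝕜 a α

instance (a α : ℝ) : AddCommGroup (DeltaIn 𝕜 a α) :=
  inferInstanceAs (AddCommGroup (deltaSubmodule 𝕜 a α))

instance (a α : ℝ) : Module 𝕜 (DeltaIn 𝕜 a α) :=
  inferInstanceAs (Module 𝕜 (deltaSubmodule 𝕜 a α))

instance (a α : ℝ) : Module ℝ (DeltaIn 𝕜 a α) :=
  inferInstanceAs (Module ℝ (deltaSubmodule 𝕜 a α))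

instance (a α : ℝ) : CoeFun (DeltaIn 𝕜 a α) (fun _ => ℝ → 𝕜) := ⟨fun f => f.1⟩

variable {𝕜}

/-- The numbers `|D^p (core α f) (x)|` for `p ≤ n` and `x ∈ [-a, a]`, `x ≠ 0`. -/
def seminormSet (a α : ℝ) (n : ℕ) (f : ℝ → 𝕜) : Set ℝ :=
  {s | ∃ (p : ℕ) (x : ℝ), p ≤ n ∧ x ∈ Icc (-a) a ∧ x ≠ 0 ∧ s = ‖iteratedDeriv p (core α f) x‖}

theorem iteratedDeriv_core {α : ℝ} {f φ : ℝ → 𝕜} (h : ∀ x, x ≠ 0 → core α f x = φ x) (p : ℕ)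
    {x : ℝ} (hx : x ≠ 0) : iteratedDeriv p (core α f) x = iteratedDeriv p φ x := by
  refine Filter.EventuallyEq.iteratedDeriv_eq p ?_
  filter_upwards [isOpen_punctured.mem_nhds hx] with y hy using h y hy

theorem bddAbove_seminormSet {a α : ℝ} (n : ℕ) {f : ℝ → 𝕜} (hf : f ∈ deltaSubmodule 𝕜 a α) :
    BddAbove (seminormSet a α n f) := by
  obtain ⟨-, -, φ, hφ⟩ := hf
  have hb : ∀ p : ℕ, ∃ C : ℝ, ∀ x ∈ Icc (-a) a, ‖iteratedDeriv p φ x‖ ≤ C := by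
    intro p
    have hc : Continuous (iteratedDeriv p φ) :=
      φ.contDiff.continuous_iteratedDeriv p (by exact_mod_cast le_top)
    exact isCompact_Icc.exists_bound_of_continuousOn hc.continuousOn
  choose C hC using hb
  refine ⟨∑ p ∈ Finset.range (n + 1), |C p|, ?_⟩
  rintro s ⟨p, x, hp, hx, hx0, rfl⟩
  rw [iteratedDeriv_core hφ p hx0]
  refine ((hC p x hx).trans (le_abs_self _)).trans ?_
  exact Finset.single_le_sum (f := fun p => |C p|) (fun _ _ => abs_nonneg _)
    (Finset.mem_range.mpr (by omega))

variable (𝕜) in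
/-- The seminorm `ρ_n` (for `α = k + 1/2`), resp. `q_n` (for `α = k + r`), of `Δ_{a,α}`:
the supremum of `|D^p (core α f) (x)|` over `p ≤ n` and `x ∈ [-a, a]`, `x ≠ 0`. -/
def DeltaIn.seminorm (a α : ℝ) (n : ℕ) : Seminorm 𝕜 (DeltaIn 𝕜 a α) :=
  Seminorm.ofSMulLE (fun f => sSup (seminormSet a α n f.1))
    (by
      refine le_antisymm (Real.sSup_le ?_ le_rfl) (Real.sSup_nonneg ?_)
      · rintro s ⟨p, x, hp, hx, hx0, rfl⟩
        have h : ∀ y : ℝ, y ≠ 0 → core α ((0 : DeltaIn 𝕜 a α).1) y = (fun _ => (0 : 𝕜)) y :=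
          fun y _ => core_zero α y
        rw [iteratedDeriv_core h p hx0, iteratedDeriv_const]
        simp
      · rintro s ⟨p, x, hp, hx, hx0, rfl⟩
        exact norm_nonneg _)
    (by
      intro f g
      refine Real.sSup_le ?_ (add_nonneg (Real.sSup_nonneg ?_) (Real.sSup_nonneg ?_))
      · rintro s ⟨p, x, hp, hx, hx0, rfl⟩
        obtain ⟨hf, hfa, φ, hφ⟩ := f.2
        obtain ⟨hg, hga, ψ, hψ⟩ := g.2
        have hp' : (p : WithTop ℕ∞) ≤ ∞ := by exact_mod_cast le_top
        have h : ∀ y : ℝ, y ≠ 0 → core α ((f + g : DeltaIn 𝕜 a α).1) y = ((φ : ℝ → 𝕜) + ψ) y := by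
          intro y hy
          change core α (f.1 + g.1) y = _
          rw [core_add α hf.2.1 hg.2.1 hfa hga hy, hφ y hy, hψ y hy]
          rfl
        rw [iteratedDeriv_core h p hx0, iteratedDeriv_add (φ.contDiff.contDiffAt.of_le hp')
          (ψ.contDiff.contDiffAt.of_le hp')]
        refine (norm_add_le _ _).trans (add_le_add ?_ ?_)
        · rw [← iteratedDeriv_core hφ p hx0]
          exact le_csSup (bddAbove_seminormSet n f.2) ⟨p, x, hp, hx, hx0, rfl⟩
        · rw [← iteratedDeriv_core hψ p hx0]
          exact le_csSup (bddAbove_seminormSet n g.2) ⟨p, x, hp, hx, hx0, rfl⟩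
      · rintro s ⟨p, x, hp, hx, hx0, rfl⟩
        exact norm_nonneg _
      · rintro s ⟨p, x, hp, hx, hx0, rfl⟩
        exact norm_nonneg _)
    (by
      intro c f
      refine Real.sSup_le ?_ (mul_nonneg (norm_nonneg _) (Real.sSup_nonneg ?_))
      · rintro s ⟨p, x, hp, hx, hx0, rfl⟩
        obtain ⟨hf, hfa, φ, hφ⟩ := f.2
        have hp' : (p : WithTop ℕ∞) ≤ ∞ := by exact_mod_cast le_top
        have h : ∀ y : ℝ, y ≠ 0 → core α ((c • f : DeltaIn 𝕜 a α).1) y = (c • (φ : ℝ → 𝕜)) y := by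
          intro y hy
          change core α (c • f.1) y = _
          rw [core_smul α c hf.2.1 hy, hφ y hy]
          rfl
        rw [iteratedDeriv_core h p hx0,
          iteratedDeriv_const_smul (φ.contDiff.contDiffAt.of_le hp'), norm_smul]
        refine mul_le_mul_of_nonneg_left ?_ (norm_nonneg _)
        rw [← iteratedDeriv_core hφ p hx0]
        exact le_csSup (bddAbove_seminormSet n f.2) ⟨p, x, hp, hx, hx0, rfl⟩
      · rintro s ⟨p, x, hp, hx, hx0, rfl⟩
        exact norm_nonneg _)

variable (𝕜)

/-- The topology of `Δ_{a,α}`: the one defined by the seminorms `DeltaIn.seminorm 𝕜 a α n`. -/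
instance (a α : ℝ) : TopologicalSpace (DeltaIn 𝕜 a α) :=
  (SeminormFamily.moduleFilterBasis (𝕜 := 𝕜) (DeltaIn.seminorm 𝕜 a α)).topology

theorem DeltaIn.withSeminorms (a α : ℝ) :
    WithSeminorms (𝕜 := 𝕜) (DeltaIn.seminorm 𝕜 a α) := ⟨rfl⟩

/-- The space `Δ_α`, the union of the spaces `Δ_{a,α}`, `a ≥ 0`. -/
def deltaUnion (α : ℝ) : Submodule 𝕜 (ℝ → 𝕜) where
  carrier := {f | ∃ a : ℝ, 0 ≤ a ∧ f ∈ deltaSubmodule 𝕜 a α}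
  zero_mem' := ⟨0, le_rfl, zero_mem _⟩
  add_mem' := by
    rintro f g ⟨a, ha, hf⟩ ⟨b, hb, hg⟩
    exact ⟨max a b, ha.trans (le_max_left _ _),
      add_mem (deltaSubmodule_mono 𝕜 (le_max_left _ _) hf)
        (deltaSubmodule_mono 𝕜 (le_max_right _ _) hg)⟩
  smul_mem' := by
    rintro c f ⟨a, ha, hf⟩
    exact ⟨a, ha, Submodule.smul_mem _ c hf⟩

/-- The space `Δ_α` as a type; it carries the inductive limit topology defined below. -/
def Delta (α : ℝ) : Type _ := deltaUnion 𝕜 α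

instance (α : ℝ) : AddCommGroup (Delta 𝕜 α) := inferInstanceAs (AddCommGroup (deltaUnion 𝕜 α))

instance (α : ℝ) : Module 𝕜 (Delta 𝕜 α) := inferInstanceAs (Module 𝕜 (deltaUnion 𝕜 α))

instance (α : ℝ) : Module ℝ (Delta 𝕜 α) := inferInstanceAs (Module ℝ (deltaUnion 𝕜 α))

instance (α : ℝ) : CoeFun (Delta 𝕜 α) (fun _ => ℝ → 𝕜) := ⟨fun f => f.1⟩

/-- The inclusion of `Δ_{a,α}` into `Δ_α`. -/
def DeltaIn.incl {a : ℝ} (ha : 0 ≤ a) (α : ℝ) (f : DeltaIn 𝕜 a α) : Delta 𝕜 α :=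
  ⟨f.1, a, ha, f.2⟩

/-- The inductive limit topology of `Δ_α`: the finest locally convex vector space topology for which
all the inclusions `Δ_{a,α} → Δ_α`, `a ≥ 0`, are continuous. -/
instance (α : ℝ) : TopologicalSpace (Delta 𝕜 α) :=
  sInf {t : TopologicalSpace (Delta 𝕜 α) |
    (∀ (a : ℝ) (ha : 0 ≤ a), Continuous[_, t] (DeltaIn.incl 𝕜 ha α)) ∧
    @IsTopologicalAddGroup (Delta 𝕜 α) t _ ∧
    @ContinuousSMul 𝕜 (Delta 𝕜 α) _ _ t ∧
    @LocallyConvexSpace ℝ (Delta 𝕜 α) _ _ _ _ t}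

/-- The compact interval `[-a, a]`; `𝓓_{symmIcc a}(ℝ, 𝕜)` is the space `𝓓_a(ℝ)`. -/
def symmIcc (a : ℝ) : TopologicalSpace.Compacts ℝ := ⟨Icc (-a) a, isCompact_Icc⟩

end BesselStruve

end

/-!
In the variable `s = x²`, on each of the two half-lines, `W_α` is up to a constant the Weyl
fractional integral `I^β` of order `β = α + 1/2`. It is written below as
`fracInt β h (y) = Γ(β)⁻¹ ∫_0^∞ v^{β-1} h(± √(y² + v)) dv`, a form in which the kernel is
independent of `y`. Two facts give the inversion formulas: the semigroup law `I^a I^b = I^{a+b}`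
(`fracInt_fracInt`, by Fubini's theorem and Euler's beta integral), and the relations
`d/dx² I^β = I^β d/dx²` (`dSq_fracInt`) and `I^1 d/dx² = -1` (`fracInt_one_dSq`). With `α = k + r`,
the operator `V_α` is up to a constant `I^{1/2-r} (d/dx²)^{k+1}`, or `(d/dx²)^{k+1}` if `r = 1/2`, so
that either composition of `V_α` and `W_α` reduces to `I^{k+1} (d/dx²)^{k+1} = (-1)^{k+1}`
(`fracDeriv_fracInt`, `fracInt_fracDeriv`).

The substitution `y = |x| t` shows that `core α` is a nonzero constant multiple of `V_α`. Hence
`core α (W_α f)` is a constant multiple of `f`: it extends to a test function, and the seminorms of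
`Δ_{a,α}` correspond to those of `𝓓_a(ℝ)`. The origin, which the former omit, is recovered by
density.

That `W_α f` belongs to `K₀` follows from the relation of `I^β` with the Euler operator `θ = x d/dx`,
`θ I^β = I^β (θ + 2β)` (`euler_fracInt`): by induction, `yⁿ (W_α f)⁽ⁿ⁾` is again the fractional
integral of a test function, and such a function has one-sided limits at the origin by dominated
convergence.

The statement on the inductive limits follows from the one on `𝓓_a(ℝ)` by the universal properties
of the two topologies.
-/

noncomputable section

namespace BesselStruve

variable {𝕜 : Type*} [RCLike 𝕜]

/-! ### Convolution of truncated powers -/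

/-- The truncated power `v₊ ^ (a - 1)`. -/
def truncPow (a v : ℝ) : ℝ := (Ioi (0 : ℝ)).indicator (fun v => v ^ (a - 1)) v

theorem measurable_truncPow (a : ℝ) : Measurable (truncPow a) :=
  Measurable.indicator (by fun_prop) measurableSet_Ioi

theorem truncPow_nonneg (a v : ℝ) : 0 ≤ truncPow a v :=
  indicator_nonneg (fun _ hv => rpow_nonneg (le_of_lt hv) _) _

theorem truncPow_of_pos (a : ℝ) {v : ℝ} (hv : 0 < v) : truncPow a v = v ^ (a - 1) :=
  indicator_of_mem (mem_Ioi.mpr hv) _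

theorem truncPow_of_nonpos (a : ℝ) {v : ℝ} (hv : v ≤ 0) : truncPow a v = 0 :=
  indicator_of_notMem (by simpa using hv) _

theorem integral_truncPow_smul (a : ℝ) (f : ℝ → 𝕜) :
    ∫ v, truncPow a v • f v = ∫ v in Ioi (0 : ℝ), v ^ (a - 1) • f v := by
  rw [← integral_indicator measurableSet_Ioi]
  congr 1
  funext v
  by_cases hv : v ∈ Ioi (0 : ℝ) <;> simp [truncPow, hv]

theorem integrable_truncPow_smul_iff (a : ℝ) (f : ℝ → 𝕜) :
    Integrable (fun v => truncPow a v • f v) ↔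
      IntegrableOn (fun v : ℝ => v ^ (a - 1) • f v) (Ioi 0) := by
  rw [← integrable_indicator_iff measurableSet_Ioi]
  refine iff_of_eq (congrArg (fun g : ℝ → 𝕜 => Integrable g volume) ?_)
  funext v
  by_cases hv : v ∈ Ioi (0 : ℝ) <;> simp [truncPow, hv]

/-- Euler's beta integral, as a convolution identity of truncated powers. -/
theorem integral_truncPow_mul_truncPow {a b : ℝ} (ha : 0 < a) (hb : 0 < b) (s : ℝ) :
    ∫ v, truncPow a v * truncPow b (s - v) =
      Gamma a * Gamma b / Gamma (a + b) * truncPow (a + b) s := by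
  rcases le_or_gt s 0 with hs | hs
  · have : ∀ v, truncPow a v * truncPow b (s - v) = 0 := by
      intro v
      rcases le_or_gt v 0 with hv | hv
      · rw [truncPow_of_nonpos a hv, zero_mul]
      · rw [truncPow_of_nonpos b (by linarith), mul_zero]
    simp [this, truncPow_of_nonpos (a + b) hs]
  · have h1 := Complex.betaIntegral_scaled (a : ℂ) (b : ℂ) hs
    rw [Complex.betaIntegral_eq_Gamma_mul_div _ _ (by simpa) (by simpa)] at h1
    have h2 : ∫ v, truncPow a v * truncPow b (s - v) =
        ∫ v in (0 : ℝ)..s, v ^ (a - 1) * (s - v) ^ (b - 1) := by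
      rw [intervalIntegral.integral_of_le hs.le, integral_Ioc_eq_integral_Ioo,
        ← integral_indicator measurableSet_Ioo]
      congr 1
      funext v
      by_cases hv : v ∈ Ioo 0 s
      · rw [indicator_of_mem hv, truncPow_of_pos a hv.1, truncPow_of_pos b (sub_pos.mpr hv.2)]
      · rw [indicator_of_notMem hv]
        rcases le_or_gt v 0 with h0 | h0
        · rw [truncPow_of_nonpos a h0, zero_mul]
        · rw [truncPow_of_nonpos b (sub_nonpos.mpr (not_lt.mp fun h => hv ⟨h0, h⟩)), mul_zero]
    rw [h2]
    rw [truncPow_of_pos _ hs]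
    have h3 : ((∫ v in (0 : ℝ)..s, v ^ (a - 1) * (s - v) ^ (b - 1) : ℝ) : ℂ) =
        ∫ v in (0 : ℝ)..s, (v : ℂ) ^ ((a : ℂ) - 1) * ((s : ℂ) - v) ^ ((b : ℂ) - 1) := by
      rw [← intervalIntegral.integral_ofReal]
      refine intervalIntegral.integral_congr fun v hv => ?_
      rw [uIcc_of_le hs.le] at hv
      push_cast
      rw [Complex.ofReal_cpow hv.1, Complex.ofReal_cpow (by linarith [hv.2])]
      push_cast
      rfl
    apply Complex.ofReal_injective
    rw [h3, h1]
    push_cast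
    rw [Complex.ofReal_cpow hs.le, ← Complex.Gamma_ofReal, ← Complex.Gamma_ofReal,
      ← Complex.Gamma_ofReal]
    push_cast
    ring

theorem integrable_truncPow_mul_truncPow {a b : ℝ} (ha : 0 < a) (hb : 0 < b) (s : ℝ) :
    Integrable fun v => truncPow a v * truncPow b (s - v) := by
  rcases le_or_gt s 0 with hs | hs
  · have : ∀ v, truncPow a v * truncPow b (s - v) = 0 := by
      intro v
      rcases le_or_gt v 0 with hv | hv
      · rw [truncPow_of_nonpos a hv, zero_mul]
      · rw [truncPow_of_nonpos b (by linarith), mul_zero]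
    simp [this]
  · -- a function with nonzero Bochner integral is integrable
    by_contra h
    have h1 := integral_truncPow_mul_truncPow ha hb s
    rw [integral_undef h, truncPow_of_pos _ hs] at h1
    have : 0 < Gamma a * Gamma b / Gamma (a + b) * s ^ (a + b - 1) := by
      have := Gamma_pos_of_pos ha
      have := Gamma_pos_of_pos hb
      have := Gamma_pos_of_pos (add_pos ha hb)
      positivity
    exact this.ne h1

/-- The composition law of fractional integrals, on the half-line. -/
theorem integral_rpow_integral_rpow {a b : ℝ} (ha : 0 < a) (hb : 0 < b) {H : ℝ → 𝕜}
    (hm : AEStronglyMeasurable H (volume.restrict (Ioi 0)))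
    (hi : IntegrableOn (fun s : ℝ => s ^ (a + b - 1) • H s) (Ioi 0)) :
    ∫ v in Ioi (0 : ℝ), v ^ (a - 1) • ∫ w in Ioi (0 : ℝ), w ^ (b - 1) • H (v + w) =
      (Gamma a * Gamma b / Gamma (a + b)) • ∫ s in Ioi (0 : ℝ), s ^ (a + b - 1) • H s := by
  set G : ℝ → 𝕜 := (Ioi (0 : ℝ)).indicator H with hG
  have hGm : AEStronglyMeasurable G := (aestronglyMeasurable_indicator_iff measurableSet_Ioi).2 hm
  have hGH : ∀ s, 0 < s → G s = H s := fun s hs => indicator_of_mem (mem_Ioi.mpr hs) _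
  set F : ℝ × ℝ → 𝕜 := fun p => (truncPow a p.1 * truncPow b (p.2 - p.1)) • G p.2 with hF
  have hFm : AEStronglyMeasurable F (volume.prod volume) := by
    refine AEStronglyMeasurable.smul ?_ hGm.comp_snd
    refine Measurable.aestronglyMeasurable ?_
    exact ((measurable_truncPow a).comp measurable_fst).mul
      ((measurable_truncPow b).comp (measurable_snd.sub measurable_fst))
  have hGi : Integrable fun s => truncPow (a + b) s • G s := by
    rw [integrable_truncPow_smul_iff]
    exact hi.congr_fun (fun s hs => by simp [hGH s hs]) measurableSet_Ioi
  have hFi : Integrable F (volume.prod volume) := by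
    rw [integrable_prod_iff' hFm]
    constructor
    · exact ae_of_all _ fun s => (integrable_truncPow_mul_truncPow ha hb s).smul_const (G s)
    · have : ∀ s, ∫ v, ‖F (v, s)‖ =
          Gamma a * Gamma b / Gamma (a + b) * ‖truncPow (a + b) s • G s‖ := by
        intro s
        have h1 : ∀ v, ‖F (v, s)‖ = truncPow a v * truncPow b (s - v) * ‖G s‖ := by
          intro v
          simp only [hF, norm_smul, norm_mul, Real.norm_of_nonneg (truncPow_nonneg _ _)]
        simp only [h1]
        rw [integral_mul_const, integral_truncPow_mul_truncPow ha hb, norm_smul,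
          Real.norm_of_nonneg (truncPow_nonneg _ _), mul_assoc]
      simp only [this]
      exact hGi.norm.const_mul _
  have hswap := integral_integral_swap (f := fun v s => F (v, s)) hFi
  have hl : ∀ v, ∫ s, F (v, s) = truncPow a v • ∫ w in Ioi (0 : ℝ), w ^ (b - 1) • H (v + w) := by
    intro v
    rcases le_or_gt v 0 with hv | hv
    · simp [hF, truncPow_of_nonpos a hv]
    · simp only [hF, mul_smul]
      rw [integral_smul, ← integral_add_left_eq_self _ v]
      simp only [add_sub_cancel_left]
      rw [integral_truncPow_smul]
      congr 1
      refine setIntegral_congr_fun measurableSet_Ioi fun w hw => ?_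
      simp only [hGH (v + w) (add_pos hv hw)]
  have hr : ∀ s, ∫ v, F (v, s) =
      (Gamma a * Gamma b / Gamma (a + b)) • (truncPow (a + b) s • G s) := by
    intro s
    simp only [hF]
    rw [integral_smul_const, integral_truncPow_mul_truncPow ha hb, mul_smul]
  simp only [hl, hr] at hswap
  rw [integral_truncPow_smul] at hswap
  rw [hswap, integral_smul, integral_truncPow_smul]
  congr 1
  exact setIntegral_congr_fun measurableSet_Ioi fun s hs => by simp only [hGH s hs]

/-! ### Functions smooth off the origin with bounded support -/

/-- The functions that are smooth on `ℝ \ {0}` and vanish outside a bounded set; there is no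
condition on their behaviour near `0`. -/
structure IsTestOffZero (h : ℝ → 𝕜) : Prop where
  contDiffOn : ContDiffOn ℝ ∞ h {0}ᶜ
  bounded : ∃ R : ℝ, ∀ x, R < |x| → h x = 0

namespace IsTestOffZero

theorem continuousOn {h : ℝ → 𝕜} (hh : IsTestOffZero h) : ContinuousOn h {0}ᶜ :=
  hh.contDiffOn.continuousOn

theorem differentiableAt {h : ℝ → 𝕜} (hh : IsTestOffZero h) {x : ℝ} (hx : x ≠ 0) :
    DifferentiableAt ℝ h x :=
  (hh.contDiffOn.differentiableOn (by simp)).differentiableAt (isOpen_punctured.mem_nhds hx)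

theorem dSq_iterate {h : ℝ → 𝕜} (hh : IsTestOffZero h) (n : ℕ) : IsTestOffZero (dSq^[n] h) :=
  ⟨contDiffOn_dSq_iterate hh.contDiffOn n, hh.bounded.imp fun _ hR => dSq_iterate_support hR n⟩

theorem dSq {h : ℝ → 𝕜} (hh : IsTestOffZero h) : IsTestOffZero (dSq h) := hh.dSq_iterate 1

/-- Such a function is bounded away from the origin. -/
theorem exists_bound {h : ℝ → 𝕜} (hh : IsTestOffZero h) {δ : ℝ} (hδ : 0 < δ) :
    ∃ M, 0 ≤ M ∧ ∀ x, δ ≤ |x| → ‖h x‖ ≤ M := by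
  obtain ⟨R, hR⟩ := hh.bounded
  have hc : IsCompact (Icc (-R) R ∩ {x : ℝ | δ ≤ |x|}) :=
    isCompact_Icc.inter_right (isClosed_le continuous_const continuous_abs)
  obtain ⟨M, hM⟩ := hc.exists_bound_of_continuousOn
    (hh.continuousOn.mono fun x hx => abs_pos.mp (hδ.trans_le hx.2))
  refine ⟨max M 0, le_max_right _ _, fun x hx => ?_⟩
  rcases le_or_gt |x| R with h1 | h1
  · exact (hM x ⟨abs_le.mp h1, hx⟩).trans (le_max_left _ _)
  · simp [hR x h1]

end IsTestOffZero

theorem dSq_iterate_congr {f g : ℝ → 𝕜} (h : EqOn f g {0}ᶜ) (n : ℕ) :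
    EqOn (dSq^[n] f) (dSq^[n] g) {0}ᶜ := by
  induction n with
  | zero => exact h
  | succ n ih =>
    simp only [Function.iterate_succ_apply']
    exact dSq_congr ih

/-! ### The point of the same sign with prescribed square -/

/-- The point on the side of `y` whose square is `y² + v`. -/
def shiftSq (y v : ℝ) : ℝ := Real.sign y * √(y ^ 2 + v)

theorem sign_mul_sign {y : ℝ} (hy : y ≠ 0) : Real.sign y * Real.sign y = 1 := by
  rcases Real.sign_apply_eq_of_ne_zero y hy with h | h <;> simp [h]

theorem abs_sign {y : ℝ} (hy : y ≠ 0) : |Real.sign y| = 1 := by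
  rcases Real.sign_apply_eq_of_ne_zero y hy with h | h <;> simp [h]

theorem abs_shiftSq {y : ℝ} (hy : y ≠ 0) (v : ℝ) : |shiftSq y v| = √(y ^ 2 + v) := by
  rw [shiftSq, abs_mul, abs_sign hy, one_mul, abs_of_nonneg (Real.sqrt_nonneg _)]

theorem abs_le_abs_shiftSq {y : ℝ} (hy : y ≠ 0) {v : ℝ} (hv : 0 ≤ v) : |y| ≤ |shiftSq y v| := by
  rw [abs_shiftSq hy]
  exact Real.abs_le_sqrt (by linarith)

theorem shiftSq_ne_zero {y : ℝ} (hy : y ≠ 0) {v : ℝ} (hv : 0 ≤ v) : shiftSq y v ≠ 0 :=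
  abs_pos.mp ((abs_pos.mpr hy).trans_le (abs_le_abs_shiftSq hy hv))

theorem shiftSq_sq {y : ℝ} (hy : y ≠ 0) {v : ℝ} (hv : 0 ≤ v) : shiftSq y v ^ 2 = y ^ 2 + v := by
  rw [← sq_abs, abs_shiftSq hy, Real.sq_sqrt (by positivity)]

theorem lt_abs_shiftSq {R y v : ℝ} (hy : y ≠ 0) (hv : R ^ 2 < v) : R < |shiftSq y v| := by
  rw [abs_shiftSq hy]
  exact Real.lt_sqrt_of_sq_lt (by nlinarith [sq_nonneg y])

theorem sign_mul_of_pos {y c : ℝ} (hc : 0 < c) : Real.sign (Real.sign y * c) = Real.sign y := by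
  rcases lt_trichotomy y 0 with h | h | h
  · rw [Real.sign_of_neg h, neg_one_mul, Real.sign_of_neg (by linarith)]
  · simp [h]
  · rw [Real.sign_of_pos h, one_mul, Real.sign_of_pos hc]

theorem shiftSq_shiftSq {y : ℝ} (hy : y ≠ 0) {v : ℝ} (hv : 0 ≤ v) (w : ℝ) :
    shiftSq (shiftSq y v) w = shiftSq y (v + w) := by
  have h1 : Real.sign (shiftSq y v) = Real.sign y := by
    refine sign_mul_of_pos (Real.sqrt_pos.mpr ?_)
    positivity
  unfold shiftSq at h1 ⊢
  rw [h1, ← add_assoc, ← shiftSq, shiftSq_sq hy hv]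

theorem continuousOn_comp_shiftSq {h : ℝ → 𝕜} (hc : ContinuousOn h {0}ᶜ) {y : ℝ} (hy : y ≠ 0) :
    ContinuousOn (fun v => h (shiftSq y v)) (Ici 0) := by
  refine hc.comp ?_ fun v hv => shiftSq_ne_zero hy hv
  unfold shiftSq
  fun_prop

theorem shiftSq_zero (y : ℝ) : shiftSq y 0 = y := by
  rw [shiftSq, add_zero, Real.sqrt_sq_eq_abs]
  rcases lt_trichotomy y 0 with h | h | h
  · rw [Real.sign_of_neg h, abs_of_neg h]; ring
  · simp [h]
  · rw [Real.sign_of_pos h, abs_of_pos h]; ring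

/-- In the variable `v`, the operator `d/dx²` is the ordinary derivative. -/
theorem hasDerivAt_comp_shiftSq_right {h : ℝ → 𝕜} (hh : IsTestOffZero h) {y : ℝ} (hy : y ≠ 0)
    {v : ℝ} (hv : 0 ≤ v) : HasDerivAt (fun v => h (shiftSq y v)) (dSq h (shiftSq y v)) v := by
  have hpos : 0 < y ^ 2 + v := by positivity
  have h1 : HasDerivAt (fun v => shiftSq y v) (Real.sign y * (1 / (2 * √(y ^ 2 + v)))) v :=
    (((hasDerivAt_id v).const_add (y ^ 2)).sqrt hpos.ne').const_mul _
  have h2 := (hh.differentiableAt (shiftSq_ne_zero hy hv)).hasDerivAt.scomp v h1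
  refine h2.congr_deriv ?_
  unfold dSq
  congr 1
  have := (Real.sqrt_pos.mpr hpos).ne'
  have h3 := sign_mul_sign hy
  have h4 : Real.sign y ≠ 0 := left_ne_zero_of_mul_eq_one h3
  rw [shiftSq]
  field_simp
  linear_combination h3

theorem hasDerivAt_comp_shiftSq_left {h : ℝ → 𝕜} (hh : IsTestOffZero h) {y : ℝ} (hy : y ≠ 0)
    {v : ℝ} (hv : 0 ≤ v) :
    HasDerivAt (fun y => h (shiftSq y v)) ((2 * y) • dSq h (shiftSq y v)) y := by
  have hpos : 0 < y ^ 2 + v := by positivity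
  have h1 : HasDerivAt (fun y => shiftSq y v)
      (Real.sign y * (2 * y / (2 * √(y ^ 2 + v)))) y := by
    have h0 : HasDerivAt (fun z : ℝ => z ^ 2 + v) (2 * y) y := by
      simpa using (hasDerivAt_pow 2 y).add_const v
    refine ((h0.sqrt hpos.ne').const_mul (Real.sign y)).congr_of_eventuallyEq ?_
    have : ∀ᶠ z in 𝓝 y, Real.sign z = Real.sign y := by
      rcases hy.lt_or_gt with h | h
      · filter_upwards [Iio_mem_nhds h] with z hz
        rw [Real.sign_of_neg h, Real.sign_of_neg hz]
      · filter_upwards [Ioi_mem_nhds h] with z hz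
        rw [Real.sign_of_pos h, Real.sign_of_pos hz]
    filter_upwards [this] with z hz
    rw [shiftSq, hz]
  have h2 := (hh.differentiableAt (shiftSq_ne_zero hy hv)).hasDerivAt.scomp y h1
  refine h2.congr_deriv ?_
  unfold dSq
  rw [smul_smul]
  congr 1
  have := (Real.sqrt_pos.mpr hpos).ne'
  have h3 := sign_mul_sign hy
  have h4 : Real.sign y ≠ 0 := left_ne_zero_of_mul_eq_one h3
  rw [shiftSq]
  field_simp
  linear_combination h3

/-! ### The Weyl fractional integral with respect to `x²` -/

/-- The Weyl fractional integral of order `β` with respect to the variable `x²`, taken on each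
of the two half-lines, and written with the variable of integration `v = x² - y²`. -/
def fracInt (β : ℝ) (h : ℝ → 𝕜) (y : ℝ) : 𝕜 :=
  (Gamma β)⁻¹ • ∫ v in Ioi (0 : ℝ), v ^ (β - 1) • h (shiftSq y v)

theorem integrableOn_rpow_indicator {β : ℝ} (hβ : 0 < β) (M S : ℝ) :
    IntegrableOn (fun v => (Iic S).indicator (fun v : ℝ => v ^ (β - 1) * M) v) (Ioi 0) := by
  rw [IntegrableOn, integrable_indicator_iff measurableSet_Iic, IntegrableOn,
    Measure.restrict_restrict measurableSet_Iic, inter_comm, Ioi_inter_Iic]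
  refine Integrable.mul_const ?_ M
  rcases le_or_gt 0 S with h | h
  · exact (intervalIntegrable_iff_integrableOn_Ioc_of_le h).mp
      (intervalIntegral.intervalIntegrable_rpow' (by linarith))
  · simp [Ioc_eq_empty_of_le h.le]

theorem aestronglyMeasurable_rpow_smul (β : ℝ) {h : ℝ → 𝕜} (hc : ContinuousOn h {0}ᶜ) {y : ℝ}
    (hy : y ≠ 0) : AEStronglyMeasurable (fun v : ℝ => v ^ (β - 1) • h (shiftSq y v))
      (volume.restrict (Ioi 0)) := by
  refine AEStronglyMeasurable.smul (Measurable.aestronglyMeasurable (by fun_prop)) ?_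
  exact ((continuousOn_comp_shiftSq hc hy).mono Ioi_subset_Ici_self).aestronglyMeasurable
    measurableSet_Ioi

theorem norm_rpow_smul_le {β M R y : ℝ} (hy : y ≠ 0) {h : ℝ → 𝕜}
    (hR : ∀ x, R < |x| → h x = 0) {v : ℝ} (hv : 0 < v) (hM : ‖h (shiftSq y v)‖ ≤ M) :
    ‖v ^ (β - 1) • h (shiftSq y v)‖ ≤ (Iic (R ^ 2)).indicator (fun v : ℝ => v ^ (β - 1) * M) v := by
  rcases le_or_gt v (R ^ 2) with h1 | h1
  · rw [indicator_of_mem (mem_Iic.mpr h1), norm_smul, Real.norm_of_nonneg (by positivity)]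
    exact mul_le_mul_of_nonneg_left hM (by positivity)
  · rw [indicator_of_notMem (by simpa using h1), hR _ (lt_abs_shiftSq hy h1)]
    simp

theorem integrableOn_rpow_smul {β : ℝ} (hβ : 0 < β) {h : ℝ → 𝕜} (hh : IsTestOffZero h) {y : ℝ}
    (hy : y ≠ 0) : IntegrableOn (fun v : ℝ => v ^ (β - 1) • h (shiftSq y v)) (Ioi 0) := by
  obtain ⟨R, hR⟩ := hh.bounded
  obtain ⟨M, -, hM⟩ := hh.exists_bound (abs_pos.mpr hy)
  refine (integrableOn_rpow_indicator hβ M (R ^ 2)).mono'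
    (aestronglyMeasurable_rpow_smul β hh.continuousOn hy) ?_
  refine (ae_restrict_iff' measurableSet_Ioi).2 (ae_of_all _ fun v hv => ?_)
  exact norm_rpow_smul_le hy hR hv (hM _ (abs_le_abs_shiftSq hy (le_of_lt hv)))

theorem fracInt_congr (β : ℝ) {f g : ℝ → 𝕜} (h : EqOn f g {0}ᶜ) :
    EqOn (fracInt β f) (fracInt β g) {0}ᶜ := by
  intro y hy
  unfold fracInt
  congr 1
  refine setIntegral_congr_fun measurableSet_Ioi fun v hv => ?_
  simp only [h (shiftSq_ne_zero hy (le_of_lt hv))]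

theorem fracInt_eq_zero_of_lt {β R : ℝ} {h : ℝ → 𝕜} (hR : ∀ x, R < |x| → h x = 0) {y : ℝ}
    (hy : y ≠ 0) (hy' : R < |y|) : fracInt β h y = 0 := by
  unfold fracInt
  rw [setIntegral_eq_zero_of_forall_eq_zero, smul_zero]
  intro v hv
  rw [hR _ (hy'.trans_le (abs_le_abs_shiftSq hy (le_of_lt hv))), smul_zero]

theorem fracInt_add {β : ℝ} (hβ : 0 < β) {f g : ℝ → 𝕜} (hf : IsTestOffZero f)
    (hg : IsTestOffZero g) {y : ℝ} (hy : y ≠ 0) :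
    fracInt β (f + g) y = fracInt β f y + fracInt β g y := by
  unfold fracInt
  rw [← smul_add, ← integral_add (integrableOn_rpow_smul hβ hf hy)
    (integrableOn_rpow_smul hβ hg hy)]
  simp only [Pi.add_apply, smul_add]

theorem fracInt_smul {R : Type*} [NormedField R] [NormedSpace R 𝕜] [SMulCommClass ℝ R 𝕜] (β : ℝ)
    (c : R) (f : ℝ → 𝕜) (y : ℝ) : fracInt β (c • f) y = c • fracInt β f y := by
  unfold fracInt
  have : SMulCommClass R ℝ 𝕜 := SMulCommClass.symm ℝ R 𝕜
  rw [smul_comm c, ← integral_smul c]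
  simp only [Pi.smul_apply, smul_comm _ c]

/-- The semigroup law of fractional integrals. -/
theorem fracInt_fracInt {a b : ℝ} (ha : 0 < a) (hb : 0 < b) {h : ℝ → 𝕜} (hh : IsTestOffZero h)
    {y : ℝ} (hy : y ≠ 0) : fracInt a (fracInt b h) y = fracInt (a + b) h y := by
  have h1 := integral_rpow_integral_rpow ha hb
    (((continuousOn_comp_shiftSq hh.continuousOn hy).mono Ioi_subset_Ici_self).aestronglyMeasurable
      measurableSet_Ioi) (integrableOn_rpow_smul (add_pos ha hb) hh hy)
  have h2 : ∫ v in Ioi (0 : ℝ), v ^ (a - 1) • fracInt b h (shiftSq y v) =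
      (Gamma b)⁻¹ • ∫ v in Ioi (0 : ℝ), v ^ (a - 1) •
        ∫ w in Ioi (0 : ℝ), w ^ (b - 1) • h (shiftSq y (v + w)) := by
    rw [← integral_smul]
    refine setIntegral_congr_fun measurableSet_Ioi fun v hv => ?_
    simp only [fracInt, shiftSq_shiftSq hy (le_of_lt hv)]
    rw [smul_comm]
  have := (Gamma_pos_of_pos ha).ne'
  have := (Gamma_pos_of_pos hb).ne'
  rw [fracInt, h2, h1, fracInt, smul_smul, smul_smul]
  congr 1
  field_simp

/-- Differentiation under the integral sign: the kernel `v ^ (β - 1)` does not depend on `y`, so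
the derivative falls on `h` alone, and `d/dx²` commutes with `fracInt β` (see `dSq_fracInt`). -/
theorem hasDerivAt_fracInt {β : ℝ} (hβ : 0 < β) {h : ℝ → 𝕜} (hh : IsTestOffZero h) {y : ℝ}
    (hy : y ≠ 0) : HasDerivAt (fracInt β h) ((2 * y) • fracInt β (dSq h) y) y := by
  have hy' : 0 < |y| := abs_pos.mpr hy
  obtain ⟨R, hR⟩ := hh.dSq.bounded
  obtain ⟨M, hM0, hM⟩ := hh.dSq.exists_bound (half_pos hy')
  have hball : ∀ x ∈ Metric.ball y (|y| / 2), |y| / 2 ≤ |x| ∧ |x| ≤ 2 * |y| := by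
    intro x hx
    rw [Metric.mem_ball, Real.dist_eq] at hx
    have h1 := abs_sub_abs_le_abs_sub y x
    have h2 := abs_sub_abs_le_abs_sub x y
    rw [abs_sub_comm] at h1
    constructor <;> linarith
  have hne : ∀ x ∈ Metric.ball y (|y| / 2), x ≠ 0 := fun x hx =>
    abs_pos.mp ((half_pos hy').trans_le (hball x hx).1)
  have hnhds := Metric.ball_mem_nhds y (half_pos hy')
  have key := hasDerivAt_integral_of_dominated_loc_of_deriv_le (μ := volume.restrict (Ioi 0))
    (F := fun x v => v ^ (β - 1) • h (shiftSq x v))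
    (F' := fun x v => (2 * x) • (v ^ (β - 1) • dSq h (shiftSq x v)))
    (bound := fun v => (2 * (2 * |y|)) *
      (Iic (R ^ 2)).indicator (fun v : ℝ => v ^ (β - 1) * M) v) hnhds
    (by
      filter_upwards [hnhds] with x hx
      exact aestronglyMeasurable_rpow_smul β hh.continuousOn (hne x hx))
    (integrableOn_rpow_smul hβ hh hy)
    ((aestronglyMeasurable_rpow_smul β hh.dSq.continuousOn hy).const_smul _)
    (by
      refine (ae_restrict_iff' measurableSet_Ioi).2 (ae_of_all _ fun v hv x hx => ?_)
      have h1 := norm_rpow_smul_le (β := β) (hne x hx) hR hv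
        (hM _ ((hball x hx).1.trans (abs_le_abs_shiftSq (hne x hx) (le_of_lt hv))))
      rw [norm_smul, norm_mul, Real.norm_of_nonneg zero_le_two, Real.norm_eq_abs]
      have := (hball x hx).2
      gcongr)
    ((integrableOn_rpow_indicator hβ M (R ^ 2)).const_mul _)
    (by
      refine (ae_restrict_iff' measurableSet_Ioi).2 (ae_of_all _ fun v hv x hx => ?_)
      rw [smul_comm]
      exact (hasDerivAt_comp_shiftSq_left hh (hne x hx) (le_of_lt hv)).const_smul (v ^ (β - 1)))
  have h2 := key.2.const_smul (Gamma β)⁻¹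
  rw [integral_smul, smul_comm] at h2
  exact h2

theorem dSq_fracInt {β : ℝ} (hβ : 0 < β) {h : ℝ → 𝕜} (hh : IsTestOffZero h) :
    EqOn (dSq (fracInt β h)) (fracInt β (dSq h)) {0}ᶜ := by
  intro y hy
  rw [dSq, (hasDerivAt_fracInt hβ hh hy).deriv, smul_smul, one_div_mul_cancel, one_smul]
  exact mul_ne_zero two_ne_zero hy

theorem IsTestOffZero.fracInt {β : ℝ} (hβ : 0 < β) {h : ℝ → 𝕜} (hh : IsTestOffZero h) :
    IsTestOffZero (fracInt β h) := by
  constructor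
  · refine contDiffOn_infty.2 fun n => ?_
    induction n generalizing h with
    | zero =>
      refine contDiffOn_zero.2 fun y hy => ?_
      exact (hasDerivAt_fracInt hβ hh hy).continuousAt.continuousWithinAt
    | succ n ih =>
      push_cast
      rw [contDiffOn_succ_iff_deriv_of_isOpen isOpen_punctured]
      refine ⟨fun y hy => (hasDerivAt_fracInt hβ hh hy).differentiableAt.differentiableWithinAt,
        by simp, ?_⟩
      refine ContDiffOn.congr
        (f := fun y => (2 * y) • BesselStruve.fracInt β (BesselStruve.dSq h) y) ?_
        fun y hy => (hasDerivAt_fracInt hβ hh hy).deriv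
      exact (contDiff_const.mul contDiff_id).contDiffOn.smul (ih hh.dSq)
  · obtain ⟨R, hR⟩ := hh.bounded
    refine ⟨max R 0, fun x hx => fracInt_eq_zero_of_lt hR ?_ ((le_max_left _ _).trans_lt hx)⟩
    exact abs_pos.mp ((le_max_right _ _).trans_lt hx)

theorem dSq_iterate_fracInt {β : ℝ} (hβ : 0 < β) {h : ℝ → 𝕜} (hh : IsTestOffZero h) (n : ℕ) :
    EqOn (dSq^[n] (fracInt β h)) (fracInt β (dSq^[n] h)) {0}ᶜ := by
  induction n with
  | zero => exact fun _ _ => rfl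
  | succ n ih =>
    simp only [Function.iterate_succ_apply']
    exact (dSq_congr ih).trans (dSq_fracInt hβ (hh.dSq_iterate n))

/-- The fundamental theorem of calculus in the variable `x²`. -/
theorem fracInt_one_dSq {h : ℝ → 𝕜} (hh : IsTestOffZero h) {y : ℝ} (hy : y ≠ 0) :
    fracInt 1 (dSq h) y = -h y := by
  have h1 := integrableOn_rpow_smul one_pos hh.dSq hy
  simp only [sub_self, Real.rpow_zero, one_smul] at h1
  obtain ⟨R, hR⟩ := hh.bounded
  have h2 : Tendsto (fun v => h (shiftSq y v)) atTop (𝓝 0) := by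
    refine tendsto_const_nhds.congr' ?_
    filter_upwards [eventually_gt_atTop (R ^ 2)] with v hv
    exact (hR _ (lt_abs_shiftSq hy hv)).symm
  have h3 := integral_Ioi_of_hasDerivAt_of_tendsto'
    (fun v hv => hasDerivAt_comp_shiftSq_right hh hy hv) h1 h2
  simp only [fracInt, sub_self, Real.rpow_zero, one_smul, Gamma_one, inv_one]
  rw [h3, shiftSq_zero, zero_sub]

theorem fracInt_add_one_dSq {β : ℝ} (hβ : 0 < β) {h : ℝ → 𝕜} (hh : IsTestOffZero h) {y : ℝ}
    (hy : y ≠ 0) : fracInt (β + 1) (dSq h) y = -fracInt β h y := by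
  rw [← fracInt_fracInt hβ one_pos hh.dSq hy,
    fracInt_congr β (g := (-1 : ℝ) • h) (fun x hx => by simp [fracInt_one_dSq hh hx]) hy,
    fracInt_smul, neg_one_smul]

/-- A fractional integral of order `n + 1` undoes `(d/dx²)^{n+1}` up to sign; this is the form in
which both `V_α W_α = 1` and `W_α V_α = 1` are obtained. -/
theorem fracInt_nat_dSq_iterate {h : ℝ → 𝕜} (hh : IsTestOffZero h) (n : ℕ) {y : ℝ} (hy : y ≠ 0) :
    fracInt (n + 1) (dSq^[n + 1] h) y = (-1 : ℝ) ^ (n + 1) • h y := by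
  induction n with
  | zero => simp [fracInt_one_dSq hh hy]
  | succ n ih =>
    rw [Function.iterate_succ_apply']
    push_cast
    rw [fracInt_add_one_dSq (by positivity) (hh.dSq_iterate _) hy, ih, pow_succ _ (n + 1)]
    simp

/-! ### The operators `W_α`, `V_α` and `core α` as fractional integrals -/

/-- The substitution `x = √(y² + v)`. -/
theorem integral_Ioi_abs_eq_fracInt {β : ℝ} (hβ : 0 < β) (h : ℝ → 𝕜) {y : ℝ} (hy : y ≠ 0) :
    ∫ x in Ioi |y|, ((x ^ 2 - y ^ 2) ^ (β - 1) * x) • h (Real.sign y * x) =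
      (Gamma β / 2) • fracInt β h y := by
  have himg : (fun v => √(y ^ 2 + v)) '' Ioi 0 = Ioi |y| := by
    ext x
    constructor
    · rintro ⟨v, hv, rfl⟩
      have hv' : 0 < v := hv
      exact Real.lt_sqrt_of_sq_lt (by rw [sq_abs]; linarith)
    · intro hx
      have hx' : |y| < x := hx
      refine ⟨x ^ 2 - y ^ 2, ?_, ?_⟩
      · exact sub_pos.mpr (sq_lt_sq' (by linarith [neg_abs_le y, abs_nonneg y])
          ((le_abs_self y).trans_lt hx'))
      · simp only [add_sub_cancel]
        exact Real.sqrt_sq ((abs_nonneg y).trans hx'.le)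
  have hpos : ∀ v ∈ Ioi (0 : ℝ), 0 < y ^ 2 + v := fun v hv => by
    have : 0 < v := hv
    positivity
  have h1 := integral_image_eq_integral_abs_deriv_smul (measurableSet_Ioi (a := (0 : ℝ)))
    (f := fun v => √(y ^ 2 + v)) (f' := fun v => 1 / (2 * √(y ^ 2 + v)))
    (fun v hv => ((((hasDerivAt_id v).const_add (y ^ 2)).sqrt (hpos v hv).ne')).hasDerivWithinAt)
    (fun v hv w hw hvw => by
      have := (Real.sqrt_inj (hpos v hv).le (hpos w hw).le).mp hvw
      linarith)
    (fun x => ((x ^ 2 - y ^ 2) ^ (β - 1) * x) • h (Real.sign y * x))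
  rw [himg] at h1
  rw [h1, fracInt, smul_smul, div_mul_eq_mul_div, mul_inv_cancel₀ (Gamma_pos_of_pos hβ).ne',
    ← integral_smul]
  refine setIntegral_congr_fun measurableSet_Ioi fun v hv => ?_
  have hs := Real.sqrt_pos.mpr (hpos v hv)
  simp only [smul_smul, shiftSq]
  rw [Real.sq_sqrt (hpos v hv).le, abs_of_pos (by positivity), add_sub_cancel_left]
  congr 1
  field_simp

/-- The substitution `y = |x| t`. -/
theorem integral_Ioi_one_eq {s : ℝ} (h : ℝ → 𝕜) {x : ℝ} (hx : x ≠ 0) :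
    (|x| ^ (2 * s + 2)) • ∫ t in Ioi (1 : ℝ), ((t ^ 2 - 1) ^ s * t) • h (x * t) =
      ∫ y in Ioi |x|, ((y ^ 2 - x ^ 2) ^ s * y) • h (Real.sign x * y) := by
  have hx' : 0 < |x| := abs_pos.mpr hx
  have h1 := integral_comp_mul_left_Ioi'
    (fun y => ((y ^ 2 - x ^ 2) ^ s * y) • h (Real.sign x * y)) 1 hx'
  rw [mul_one] at h1
  rw [← h1, ← integral_smul, ← integral_smul]
  refine setIntegral_congr_fun measurableSet_Ioi fun t ht => ?_
  have ht' : 1 < t := ht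
  have h2 : Real.sign x * (|x| * t) = x * t := by
    rw [← mul_assoc]
    congr 1
    rcases hx.lt_or_gt with h | h
    · rw [Real.sign_of_neg h, abs_of_neg h, neg_one_mul, neg_neg]
    · rw [Real.sign_of_pos h, abs_of_pos h, one_mul]
  have h3 : (|x| * t) ^ 2 - x ^ 2 = |x| ^ 2 * (t ^ 2 - 1) := by rw [← sq_abs x]; ring
  simp only [smul_smul, h2, h3]
  congr 1
  rw [Real.mul_rpow (by positivity) (by nlinarith), Real.rpow_add hx', Real.rpow_mul hx'.le,
    Real.rpow_two]
  ring

theorem weylW_eq_fracInt {α : ℝ} (hα : -(1 / 2) < α) (f : ℝ → 𝕜) {y : ℝ} (hy : y ≠ 0) :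
    weylW α f y = (Gamma (α + 1) / √π) • fracInt (α + 1 / 2) f y := by
  have h0 : 0 < α + 1 / 2 := by linarith
  have h1 := integral_Ioi_abs_eq_fracInt h0 f hy
  rw [show α + 1 / 2 - 1 = α - 1 / 2 by ring] at h1
  rw [weylW, h1, smul_smul]
  congr 1
  have h2 := (Gamma_pos_of_pos h0).ne'
  have h3 := (Real.sqrt_pos.mpr Real.pi_pos).ne'
  generalize Gamma (α + 1 / 2) = c at h2
  field_simp

open Classical in
/-- The inverse of `fracInt (α + 1/2)` up to sign: `d/dx²` is applied `k + 1` times, and the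
excess in the order is compensated by a fractional integral of order `1/2 - r`. -/
def fracDeriv (α : ℝ) (f : ℝ → 𝕜) : ℝ → 𝕜 :=
  if α = ord α + 1 / 2 then dSq^[ord α + 1] f
  else fracInt (1 / 2 - frac α) (dSq^[ord α + 1] f)

open Classical in
/-- The factor between `core α` and `fracDeriv α`. -/
def coreConst (α : ℝ) : ℝ := if α = ord α + 1 / 2 then 1 else Gamma (1 / 2 - frac α) / 2

theorem half_sub_frac_pos {α : ℝ} (h : α ≠ ord α + 1 / 2) : 0 < 1 / 2 - frac α :=
  sub_pos.mpr (frac_lt_half α h)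

theorem coreConst_pos (α : ℝ) : 0 < coreConst α := by
  unfold coreConst
  split_ifs with h
  · exact one_pos
  · exact half_pos (Gamma_pos_of_pos (half_sub_frac_pos h))

theorem core_eq_fracDeriv (α : ℝ) (f : ℝ → 𝕜) {x : ℝ} (hx : x ≠ 0) :
    core α f x = coreConst α • fracDeriv α f x := by
  unfold core coreConst fracDeriv
  split_ifs with h
  · rw [one_smul]
  · have h1 := integral_Ioi_one_eq (s := -frac α - 1 / 2) (dSq^[ord α + 1] f) hx
    rw [show 2 * (-frac α - 1 / 2) + 2 = 1 - 2 * frac α by ring] at h1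
    rw [h1, ← integral_Ioi_abs_eq_fracInt (half_sub_frac_pos h) _ hx,
      show 1 / 2 - frac α - 1 = -frac α - 1 / 2 by ring]

/-- The constant of `V_α` for `α = k + 1/2` agrees with the general one, by the duplication
formula. -/
theorem Gamma_nat_add_three_half (k : ℕ) :
    √π / Gamma ((k : ℝ) + 1 / 2 + 1) =
      2 ^ (2 * k + 1) * (Nat.factorial k : ℝ) / (Nat.factorial (2 * k + 1) : ℝ) := by
  have h := Real.Gamma_mul_Gamma_add_half ((k : ℝ) + 1)
  have h1 : Gamma ((k : ℝ) + 1) = k.factorial := Real.Gamma_nat_eq_factorial k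
  have h2 : Gamma (2 * ((k : ℝ) + 1)) = (2 * k + 1).factorial := by
    rw [← Real.Gamma_nat_eq_factorial]
    congr 1
    push_cast
    ring
  have h3 : (2 : ℝ) ^ (1 - 2 * ((k : ℝ) + 1)) = (2 ^ (2 * k + 1))⁻¹ := by
    rw [show 1 - 2 * ((k : ℝ) + 1) = -((2 * k + 1 : ℕ) : ℝ) by push_cast; ring,
      Real.rpow_neg zero_le_two, Real.rpow_natCast]
  rw [h1, h2, h3, show (k : ℝ) + 1 + 1 / 2 = k + 1 / 2 + 1 by ring] at h
  have : 0 < Gamma ((k : ℝ) + 1 / 2 + 1) := Gamma_pos_of_pos (by positivity)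
  have h4 : ((2 * k + 1).factorial : ℝ) ≠ 0 := by positivity
  rw [div_eq_div_iff this.ne' h4]
  have h5 : (2 : ℝ) ^ (2 * k + 1) ≠ 0 := by positivity
  generalize Gamma ((k : ℝ) + 1 / 2 + 1) = c at h ⊢
  field_simp at h
  linear_combination -h

theorem weylV_eq_fracDeriv (α : ℝ) (f : ℝ → 𝕜) {x : ℝ} (hx : x ≠ 0) :
    weylV α f x = ((-1) ^ (ord α + 1) * (√π / Gamma (α + 1))) • fracDeriv α f x := by
  unfold weylV fracDeriv
  split_ifs with h
  · rw [← Gamma_nat_add_three_half, ← h]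
  · have h0 := half_sub_frac_pos h
    have h1 := integral_Ioi_abs_eq_fracInt h0 (dSq^[ord α + 1] f) hx
    rw [show 1 / 2 - frac α - 1 = -frac α - 1 / 2 by ring] at h1
    rw [h1, smul_smul]
    congr 1
    have h2 := (Gamma_pos_of_pos h0).ne'
    generalize Gamma (1 / 2 - frac α) = c at h2
    generalize Gamma (α + 1) = d
    generalize (-1 : ℝ) ^ (ord α + 1) = e
    field_simp

/-! ### Inversion -/

theorem fracDeriv_congr (α : ℝ) {f g : ℝ → 𝕜} (h : EqOn f g {0}ᶜ) :
    EqOn (fracDeriv α f) (fracDeriv α g) {0}ᶜ := by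
  unfold fracDeriv
  split_ifs
  · exact dSq_iterate_congr h _
  · exact fracInt_congr _ (dSq_iterate_congr h _)

theorem fracInt_fracDeriv {α : ℝ} (hα : -(1 / 2) < α) {f : ℝ → 𝕜} (hf : IsTestOffZero f) {x : ℝ}
    (hx : x ≠ 0) :
    fracInt (α + 1 / 2) (fracDeriv α f) x = (-1 : ℝ) ^ (ord α + 1) • f x := by
  rw [← fracInt_nat_dSq_iterate hf _ hx]
  unfold fracDeriv
  split_ifs with h
  · rw [show α + 1 / 2 = ord α + 1 by linarith]
  · rw [fracInt_fracInt (by linarith) (half_sub_frac_pos h) (hf.dSq_iterate _) hx]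
    congr 1
    unfold frac
    ring

theorem fracDeriv_fracInt {α : ℝ} (hα : -(1 / 2) < α) {f : ℝ → 𝕜} (hf : IsTestOffZero f) {x : ℝ}
    (hx : x ≠ 0) :
    fracDeriv α (fracInt (α + 1 / 2) f) x = (-1 : ℝ) ^ (ord α + 1) • f x := by
  have h0 : 0 < α + 1 / 2 := by linarith
  rw [← fracInt_nat_dSq_iterate hf _ hx]
  unfold fracDeriv
  split_ifs with h
  · rw [dSq_iterate_fracInt h0 hf _ hx, show α + 1 / 2 = ord α + 1 by linarith]
  · rw [fracInt_congr _ (dSq_iterate_fracInt h0 hf _) hx,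
      fracInt_fracInt (half_sub_frac_pos h) h0 (hf.dSq_iterate _) hx]
    congr 1
    unfold frac
    ring

/-! ### Behaviour of fractional integrals at the origin -/

/-- In particular this holds for the test functions on `ℝ`. -/
theorem IsTestOffZero.of_contDiff {h : ℝ → 𝕜} (hc : ContDiff ℝ ∞ h) {R : ℝ}
    (hR : ∀ x, R < |x| → h x = 0) : IsTestOffZero h := ⟨hc.contDiffOn, R, hR⟩

theorem IsTestOffZero.const_smul {f : ℝ → 𝕜} (hf : IsTestOffZero f) (c : ℝ) :
    IsTestOffZero (c • f) :=
  ⟨hf.contDiffOn.const_smul c, hf.bounded.imp fun _ hR x hx => by simp [hR x hx]⟩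

/-- The commutation relation of `fracInt β` with the Euler operator `x d/dx`: as `fracInt β` is
homogeneous of degree `2β`, the two commute up to the term `2β`. -/
theorem euler_fracInt {β : ℝ} (hβ : 0 < β) {h : ℝ → 𝕜} (hh : IsTestOffZero h) {y : ℝ}
    (hy : y ≠ 0) :
    y • ((2 * y) • fracInt β (dSq h) y) =
      fracInt β (fun x => x • deriv h x) y + (2 * β) • fracInt β h y := by
  have i1 := integrableOn_rpow_smul hβ hh.dSq hy
  have i2 := integrableOn_rpow_smul (add_pos hβ one_pos) hh.dSq hy
  -- With `v = x² - y²`, the operator `x d/dx = 2x² d/dx²` is `2y² d/dx² + 2v d/dx²`.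
  have h1 : ∫ v in Ioi (0 : ℝ), v ^ (β - 1) • (shiftSq y v • deriv h (shiftSq y v)) =
      (2 * y ^ 2) • (∫ v in Ioi (0 : ℝ), v ^ (β - 1) • dSq h (shiftSq y v)) +
        (2 : ℝ) • ∫ v in Ioi (0 : ℝ), v ^ (β + 1 - 1) • dSq h (shiftSq y v) := by
    have h0 := integral_add (i1.smul (2 * y ^ 2)) (i2.smul (2 : ℝ))
    simp only [Pi.smul_apply, integral_smul] at h0
    rw [← h0]
    refine setIntegral_congr_fun measurableSet_Ioi fun v hv => ?_
    have hv' : 0 < v := hv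
    have hne := shiftSq_ne_zero hy hv'.le
    have h2 : shiftSq y v • deriv h (shiftSq y v) =
        (2 * (y ^ 2 + v)) • dSq h (shiftSq y v) := by
      rw [← shiftSq_sq hy hv'.le, dSq, smul_smul]
      congr 1
      field_simp
    simp only [h2, smul_smul, ← add_smul]
    congr 1
    rw [add_sub_cancel_right, Real.rpow_sub_one hv'.ne']
    field_simp
  have h3 : (2 : ℝ) • (∫ v in Ioi (0 : ℝ), v ^ (β + 1 - 1) • dSq h (shiftSq y v)) =
      -((2 * β * Gamma β) • fracInt β h y) := by
    have h4 := fracInt_add_one_dSq hβ hh hy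
    rw [← smul_neg, ← h4, fracInt, smul_smul, Real.Gamma_add_one hβ.ne']
    congr 1
    have := (Gamma_pos_of_pos hβ).ne'
    field_simp
  have h5 : fracInt β (fun x => x • deriv h x) y =
      (Gamma β)⁻¹ • ((2 * y ^ 2) • (∫ v in Ioi (0 : ℝ), v ^ (β - 1) • dSq h (shiftSq y v)) +
        -((2 * β * Gamma β) • fracInt β h y)) := by
    rw [← h3, ← h1, fracInt]
  have h6 : (Gamma β)⁻¹ * (2 * β * Gamma β) = 2 * β := by
    have := (Gamma_pos_of_pos hβ).ne'
    field_simp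
  rw [h5, smul_add, smul_neg, smul_smul _ (2 * β * Gamma β), h6, neg_add_cancel_right, fracInt,
    smul_smul, smul_smul, smul_smul]
  congr 1
  ring

theorem contDiffOn_iteratedDeriv {h : ℝ → 𝕜} (hh : IsTestOffZero h) (n : ℕ) :
    ContDiffOn ℝ ∞ (iteratedDeriv n h) {0}ᶜ := by
  induction n with
  | zero => simpa using hh.contDiffOn
  | succ n ih =>
    rw [iteratedDeriv_succ]
    exact ih.deriv_of_isOpen isOpen_punctured le_rfl

/-- By `euler_fracInt`, `yⁿ (d/dy)ⁿ` turns the fractional integral of a test function into the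
fractional integral of another test function. -/
theorem exists_pow_smul_iteratedDeriv_fracInt {β : ℝ} (hβ : 0 < β) {f : ℝ → 𝕜}
    (hf : ContDiff ℝ ∞ f) {R : ℝ} (hR : ∀ x, R < |x| → f x = 0) (n : ℕ) :
    ∃ h : ℝ → 𝕜, ContDiff ℝ ∞ h ∧ (∀ x, R < |x| → h x = 0) ∧
      ∀ y, y ≠ 0 → y ^ n • iteratedDeriv n (fracInt β f) y = fracInt β h y := by
  induction n with
  | zero => exact ⟨f, hf, hR, fun y _ => by simp⟩
  | succ n ih =>
    obtain ⟨h, hc, hhR, heq⟩ := ih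
    have hF := (IsTestOffZero.of_contDiff hf hR).fracInt hβ
    have hh := IsTestOffZero.of_contDiff hc hhR
    have hdc : ContDiff ℝ ∞ (fun x => x • deriv h x) := contDiff_id.smul hc.deriv'
    have hdR : ∀ x, R < |x| → x • deriv h x = 0 := by
      intro x hx
      have h1 : h =ᶠ[𝓝 x] fun _ => 0 := by
        filter_upwards [(isOpen_lt continuous_const continuous_abs).mem_nhds hx] with z hz
          using hhR z hz
      simp [h1.deriv_eq]
    refine ⟨(fun x => x • deriv h x) + (2 * β - n) • h, hdc.add (hc.const_smul (2 * β - n : ℝ)),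
      fun x hx => by simp only [Pi.add_apply, Pi.smul_apply, hdR x hx, hhR x hx]; simp,
      fun y hy => ?_⟩
    have hnhds := isOpen_punctured.mem_nhds hy
    have h1 : HasDerivAt (iteratedDeriv n (fracInt β f))
        (iteratedDeriv (n + 1) (fracInt β f) y) y := by
      rw [iteratedDeriv_succ]
      exact (((contDiffOn_iteratedDeriv hF n).differentiableOn (by simp)).differentiableAt
        hnhds).hasDerivAt
    have h2 := (hasDerivAt_pow n y).smul h1
    have h3 : HasDerivAt (fun z => z ^ n • iteratedDeriv n (fracInt β f) z)
        ((2 * y) • fracInt β (dSq h) y) y :=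
      (hasDerivAt_fracInt hβ hh hy).congr_of_eventuallyEq
        (by filter_upwards [hnhds] with z hz using heq z hz)
    have h4 := congrArg (fun z => y • z) (h2.unique h3)
    simp only [smul_add, euler_fracInt hβ hh hy] at h4
    have h5 : y • ((n * y ^ (n - 1) : ℝ) • iteratedDeriv n (fracInt β f) y) =
        (n : ℝ) • fracInt β h y := by
      rw [← heq y hy, smul_smul, smul_smul]
      congr 1
      cases n
      · simp
      · simp only [Nat.add_sub_cancel]
        ring
    rw [h5, smul_smul, ← pow_succ'] at h4
    rw [fracInt_add hβ (IsTestOffZero.of_contDiff hdc hdR)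
      (hh.const_smul _) hy, fracInt_smul, sub_smul,
      ← add_sub_assoc, ← h4, add_sub_cancel_right]

/-- The fractional integral of a continuous function of bounded support has limits at the origin
from either side, `l` being the filter `𝓝[>] 0` or `𝓝[<] 0`. -/
theorem exists_tendsto_fracInt {β : ℝ} (hβ : 0 < β) {h : ℝ → 𝕜} (hc : Continuous h) {R : ℝ}
    (hR : ∀ x, R < |x| → h x = 0) {l : Filter ℝ} [l.IsCountablyGenerated] (hl : l ≤ 𝓝 0) {s : ℝ}
    (hs : ∀ᶠ y in l, y ≠ 0 ∧ Real.sign y = s) : ∃ m, Tendsto (fracInt β h) l (𝓝 m) := by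
  obtain ⟨M, hM⟩ := (HasCompactSupport.intro (isCompact_Icc (a := -R) (b := R)) fun x hx =>
    hR x (not_le.mp fun h => hx (abs_le.mp h))).exists_bound_of_continuous hc
  refine ⟨(Gamma β)⁻¹ • ∫ v in Ioi (0 : ℝ), v ^ (β - 1) • h (s * √v), Tendsto.const_smul ?_ _⟩
  refine tendsto_integral_filter_of_dominated_convergence
    (fun v => (Iic (R ^ 2)).indicator (fun v : ℝ => v ^ (β - 1) * M) v) ?_ ?_
    (integrableOn_rpow_indicator hβ M (R ^ 2)) ?_
  · filter_upwards [hs] with y hy using aestronglyMeasurable_rpow_smul β hc.continuousOn hy.1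
  · filter_upwards [hs] with y hy
    exact (ae_restrict_iff' measurableSet_Ioi).2
      (ae_of_all _ fun v hv => norm_rpow_smul_le hy.1 hR hv (hM _))
  · refine (ae_restrict_iff' measurableSet_Ioi).2 (ae_of_all _ fun v hv => ?_)
    refine Tendsto.const_smul ?_ _
    have h1 : Tendsto (fun y : ℝ => h (s * √(y ^ 2 + v))) l (𝓝 (h (s * √v))) := by
      have : Continuous fun y : ℝ => h (s * √(y ^ 2 + v)) := by fun_prop
      have h2 := (this.tendsto 0).mono_left hl
      simpa using h2
    refine h1.congr' ?_
    filter_upwards [hs] with y hy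
    rw [shiftSq, hy.2]

/-- The representative of a function on `ℝ \ {0}` that vanishes at `0`. -/
def puncture (g : ℝ → 𝕜) : ℝ → 𝕜 := Function.update g 0 0

theorem puncture_zero (g : ℝ → 𝕜) : puncture g 0 = 0 := by simp [puncture]

theorem puncture_of_ne (g : ℝ → 𝕜) {x : ℝ} (hx : x ≠ 0) : puncture g x = g x := by
  simp [puncture, hx]

theorem puncture_eqOn (g : ℝ → 𝕜) : EqOn (puncture g) g {0}ᶜ := fun _ hx => puncture_of_ne g hx

theorem puncture_fracInt_mem_K₀ {β : ℝ} (hβ : 0 < β) {f : ℝ → 𝕜} (hf : ContDiff ℝ ∞ f) {R : ℝ}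
    (hR : ∀ x, R < |x| → f x = 0) : puncture (fracInt β f) ∈ K₀ 𝕜 := by
  have hF := (IsTestOffZero.of_contDiff hf hR).fracInt hβ
  obtain ⟨S, hS⟩ := hF.bounded
  refine ⟨puncture_zero _, hF.contDiffOn.congr (puncture_eqOn _), ⟨max S 0, fun x hx => ?_⟩,
    fun n => ?_⟩
  · rw [puncture_of_ne _ (abs_pos.mp ((le_max_right _ _).trans_lt hx)),
      hS x ((le_max_left _ _).trans_lt hx)]
  · obtain ⟨h, hc, hhR, heq⟩ := exists_pow_smul_iteratedDeriv_fracInt hβ hf hR n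
    have key : ∀ y, y ≠ 0 →
        fracInt β h y = y ^ n • iteratedDeriv n (puncture (fracInt β f)) y := by
      intro y hy
      rw [← heq y hy, Filter.EventuallyEq.iteratedDeriv_eq n
        ((puncture_eqOn (fracInt β f)).eventuallyEq_of_mem (isOpen_punctured.mem_nhds hy))]
    constructor
    · have hs : ∀ᶠ y in 𝓝[>] (0 : ℝ), y ≠ 0 ∧ Real.sign y = 1 := by
        filter_upwards [self_mem_nhdsWithin] with y hy using ⟨ne_of_gt hy, Real.sign_of_pos hy⟩
      obtain ⟨m, hm⟩ := exists_tendsto_fracInt hβ hc.continuous hhR nhdsWithin_le_nhds hs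
      exact ⟨m, hm.congr' (hs.mono fun y hy => key y hy.1)⟩
    · have hs : ∀ᶠ y in 𝓝[<] (0 : ℝ), y ≠ 0 ∧ Real.sign y = -1 := by
        filter_upwards [self_mem_nhdsWithin] with y hy using ⟨ne_of_lt hy, Real.sign_of_neg hy⟩
      obtain ⟨m, hm⟩ := exists_tendsto_fracInt hβ hc.continuous hhR nhdsWithin_le_nhds hs
      exact ⟨m, hm.congr' (hs.mono fun y hy => key y hy.1)⟩

/-! ### The Weyl integral of a test function -/

/-- The constant with `core α (W_α f) = transConst α • f` and
`V_α g = (transConst α)⁻¹ • core α g`. -/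
def transConst (α : ℝ) : ℝ := coreConst α * ((-1) ^ (ord α + 1) * (Gamma (α + 1) / √π))

theorem transConst_ne_zero {α : ℝ} (hα : -(1 / 2) < α) : transConst α ≠ 0 :=
  mul_ne_zero (coreConst_pos α).ne' (mul_ne_zero (pow_ne_zero _ (by norm_num))
    (div_pos (Gamma_pos_of_pos (by linarith)) (Real.sqrt_pos.mpr Real.pi_pos)).ne')

theorem weylV_eq_core (α : ℝ) (g : ℝ → 𝕜) {x : ℝ} (hx : x ≠ 0) :
    weylV α g x = (transConst α)⁻¹ • core α g x := by
  rw [weylV_eq_fracDeriv α g hx, core_eq_fracDeriv α g hx, smul_smul, transConst]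
  congr 1
  rw [mul_inv, mul_right_comm, inv_mul_cancel₀ (coreConst_pos α).ne', one_mul, mul_inv, inv_div,
    ← inv_pow]
  norm_num

theorem weylW_eqOn_fracInt {α : ℝ} (hα : -(1 / 2) < α) (f : ℝ → 𝕜) :
    EqOn (weylW α f) (fracInt (α + 1 / 2) ((Gamma (α + 1) / √π) • f)) {0}ᶜ := by
  intro y hy
  rw [weylW_eq_fracInt hα f hy, fracInt_smul]

theorem core_congr (α : ℝ) {f g : ℝ → 𝕜} (h : EqOn f g {0}ᶜ) {x : ℝ} (hx : x ≠ 0) :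
    core α f x = core α g x := by
  rw [core_eq_fracDeriv α f hx, core_eq_fracDeriv α g hx, fracDeriv_congr α h hx]

theorem core_puncture_weylW {α : ℝ} (hα : -(1 / 2) < α) {f : ℝ → 𝕜} (hf : IsTestOffZero f) {x : ℝ}
    (hx : x ≠ 0) : core α (puncture (weylW α f)) x = transConst α • f x := by
  rw [core_congr α ((puncture_eqOn _).trans (weylW_eqOn_fracInt hα f)) hx,
    core_eq_fracDeriv α _ hx, fracDeriv_fracInt hα (hf.const_smul _) hx, transConst]
  simp only [Pi.smul_apply, smul_smul]

/-- `W_α` is a left inverse of `V_α`, stated for any function `φ` that agrees with `V_α g` off the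
origin. -/
theorem weylW_smul_core {α : ℝ} (hα : -(1 / 2) < α) {g φ : ℝ → 𝕜} (hg : IsTestOffZero g)
    (hφ : ∀ x, x ≠ 0 → φ x = (transConst α)⁻¹ • core α g x) {x : ℝ} (hx : x ≠ 0) :
    weylW α φ x = g x := by
  have h1 : EqOn φ (((-1) ^ (ord α + 1) * (√π / Gamma (α + 1))) • fracDeriv α g) {0}ᶜ := by
    intro z hz
    rw [hφ z hz, ← weylV_eq_core α g hz, weylV_eq_fracDeriv α g hz]
    rfl
  rw [weylW_eq_fracInt hα φ hx, fracInt_congr _ h1 hx, fracInt_smul, fracInt_fracDeriv hα hg hx,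
    smul_smul, smul_smul]
  have h2 : Gamma (α + 1) ≠ 0 := (Gamma_pos_of_pos (by linarith)).ne'
  have h3 : √π ≠ 0 := (Real.sqrt_pos.mpr Real.pi_pos).ne'
  have h4 : Gamma (α + 1) / √π * ((-1) ^ (ord α + 1) * (√π / Gamma (α + 1))) * (-1) ^ (ord α + 1) =
      1 := by
    have : ((-1 : ℝ) ^ (ord α + 1)) * (-1) ^ (ord α + 1) = 1 := by
      rw [← mul_pow]; norm_num
    generalize (-1 : ℝ) ^ (ord α + 1) = e at this ⊢
    field_simp
    linear_combination this
  rw [h4, one_smul]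

theorem puncture_weylW_mem_deltaSubmodule {α : ℝ} (hα : -(1 / 2) < α) {a : ℝ} (ha : 0 ≤ a)
    {f : ℝ → 𝕜} (hf : ContDiff ℝ ∞ f) (hfa : ∀ x, a < |x| → f x = 0) :
    puncture (weylW α f) ∈ deltaSubmodule 𝕜 a α := by
  set c := Gamma (α + 1) / √π with hc
  have hf' := IsTestOffZero.of_contDiff hf hfa
  have hca : ∀ x, a < |x| → (c • f) x = 0 := fun x hx => by simp [hfa x hx]
  have heq : puncture (weylW α f) = puncture (fracInt (α + 1 / 2) (c • f)) := by
    funext x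
    by_cases hx : x = 0
    · rw [hx, puncture_zero, puncture_zero]
    · rw [puncture_of_ne _ hx, puncture_of_ne _ hx, weylW_eqOn_fracInt hα f hx]
  refine ⟨?_, fun x hx => ?_, ⟨transConst α • f, hf.const_smul (transConst α), ?_, fun _ _ => trivial⟩,
    fun x hx => core_puncture_weylW hα hf' hx⟩
  · rw [heq]
    exact puncture_fracInt_mem_K₀ (by linarith) (hf.const_smul c) hca
  · have hx0 : x ≠ 0 := abs_pos.mp (ha.trans_lt hx)
    rw [heq, puncture_of_ne _ hx0, fracInt_eq_zero_of_lt hca hx0 hx]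
  · refine HasCompactSupport.intro (isCompact_Icc (a := -a) (b := a)) fun x hx => ?_
    simp [hfa x (not_le.mp fun h => hx (abs_le.mp h))]

/-! ### The Weyl integral as a linear bijection -/

theorem puncture_weylW_add {α : ℝ} (hα : -(1 / 2) < α) {f g : ℝ → 𝕜} (hf : IsTestOffZero f)
    (hg : IsTestOffZero g) :
    puncture (weylW α (f + g)) = puncture (weylW α f) + puncture (weylW α g) := by
  funext x
  by_cases hx : x = 0
  · simp [hx, puncture_zero]
  · rw [Pi.add_apply, puncture_of_ne _ hx, puncture_of_ne _ hx, puncture_of_ne _ hx,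
      weylW_eq_fracInt hα _ hx, weylW_eq_fracInt hα _ hx, weylW_eq_fracInt hα _ hx,
      fracInt_add (by linarith) hf hg hx, smul_add]

theorem puncture_weylW_smul {α : ℝ} (hα : -(1 / 2) < α) (c : 𝕜) (f : ℝ → 𝕜) :
    puncture (weylW α (c • f)) = c • puncture (weylW α f) := by
  funext x
  by_cases hx : x = 0
  · simp [hx, puncture_zero]
  · rw [Pi.smul_apply, puncture_of_ne _ hx, puncture_of_ne _ hx,
      weylW_eq_fracInt hα _ hx, weylW_eq_fracInt hα _ hx, fracInt_smul, smul_comm]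

/-- `core α` recovers a continuous function from its Weyl integral, off the origin and hence
everywhere. -/
theorem eq_of_puncture_weylW_eq {α : ℝ} (hα : -(1 / 2) < α) {f g : ℝ → 𝕜} (hf : IsTestOffZero f)
    (hg : IsTestOffZero g) (hfc : Continuous f) (hgc : Continuous g)
    (h : puncture (weylW α f) = puncture (weylW α g)) : f = g := by
  refine Continuous.ext_on (dense_compl_singleton (0 : ℝ)) hfc hgc fun x hx => ?_
  have h1 := core_puncture_weylW hα hf hx
  rw [h, core_puncture_weylW hα hg hx] at h1
  exact (smul_right_injective 𝕜 (transConst_ne_zero hα) h1).symm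

theorem isTestOffZero_of_mem {a α : ℝ} {g : ℝ → 𝕜} (hg : g ∈ deltaSubmodule 𝕜 a α) :
    IsTestOffZero g := ⟨hg.1.2.1, a, hg.2.1⟩

theorem core_eq_zero_of_lt {α a : ℝ} {g : ℝ → 𝕜} (hga : ∀ x, a < |x| → g x = 0) {x : ℝ}
    (hx : x ≠ 0) (hxa : a < |x|) : core α g x = 0 := by
  rw [core_eq_fracDeriv α g hx, fracDeriv]
  have h := dSq_iterate_support hga (ord α + 1)
  split_ifs
  · rw [h x hxa, smul_zero]
  · rw [fracInt_eq_zero_of_lt h hx hxa, smul_zero]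

/-- Every element of `Δ_{a,α}` is the Weyl integral of a test function supported in `[-a, a]`. -/
theorem exists_weylW_eq {α : ℝ} (hα : -(1 / 2) < α) {a : ℝ} (ha : 0 ≤ a) {g : ℝ → 𝕜}
    (hg : g ∈ deltaSubmodule 𝕜 a α) :
    ∃ f : ℝ → 𝕜, ContDiff ℝ ∞ f ∧ (∀ x, a < |x| → f x = 0) ∧ puncture (weylW α f) = g := by
  obtain ⟨φ, hφ⟩ := hg.2.2
  refine ⟨(transConst α)⁻¹ • φ, φ.contDiff.const_smul (transConst α)⁻¹, fun x hx => ?_, ?_⟩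
  · have hx0 : x ≠ 0 := abs_pos.mp (ha.trans_lt hx)
    rw [Pi.smul_apply, ← hφ x hx0, core_eq_zero_of_lt hg.2.1 hx0 hx, smul_zero]
  · funext x
    by_cases hx : x = 0
    · rw [hx, puncture_zero, hg.1.1]
    · rw [puncture_of_ne _ hx]
      exact weylW_smul_core hα (isTestOffZero_of_mem hg)
        (fun z hz => by rw [Pi.smul_apply, hφ z hz]) hx

theorem eq_zero_of_supportedIn {a : ℝ} (f : 𝓓_{symmIcc a}(ℝ, 𝕜)) {x : ℝ} (hx : a < |x|) :
    f x = 0 :=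
  f.zero_on_compl fun h => absurd (abs_le.mpr h) (not_le.mpr hx)

theorem isTestOffZero_supportedIn {a : ℝ} (f : 𝓓_{symmIcc a}(ℝ, 𝕜)) : IsTestOffZero f :=
  .of_contDiff f.contDiff fun _ hx => eq_zero_of_supportedIn f hx

theorem exists_supportedIn_bound {K : Set ℝ} (hK : IsCompact K) :
    ∃ a : ℝ, 0 ≤ a ∧ K ⊆ symmIcc a := by
  obtain ⟨C, hC⟩ := hK.isBounded.exists_norm_le
  exact ⟨max C 0, le_max_right _ _, fun x hx => abs_le.mp ((hC x hx).trans (le_max_left _ _))⟩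

theorem exists_testFunction_bound (f : 𝓓((⊤ : TopologicalSpace.Opens ℝ), 𝕜)) :
    ∃ a : ℝ, 0 ≤ a ∧ ∀ x, a < |x| → f x = 0 := by
  obtain ⟨a, ha, h⟩ := exists_supportedIn_bound f.hasCompactSupport
  exact ⟨a, ha, fun x hx => image_eq_zero_of_notMem_tsupport
    fun hxt => absurd (abs_le.mpr (h hxt)) (not_le.mpr hx)⟩

theorem isTestOffZero_testFunction (f : 𝓓((⊤ : TopologicalSpace.Opens ℝ), 𝕜)) :
    IsTestOffZero f :=
  .of_contDiff f.contDiff (exists_testFunction_bound f).choose_spec.2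

/-- The Weyl integral as a linear isomorphism of `𝓓_a(ℝ)` onto `Δ_{a,α}`. -/
def weylEquivIn {α : ℝ} (hα : -(1 / 2) < α) {a : ℝ} (ha : 0 ≤ a) :
    𝓓_{symmIcc a}(ℝ, 𝕜) ≃ₗ[𝕜] DeltaIn 𝕜 a α :=
  LinearEquiv.ofBijective
    { toFun := fun f => ⟨puncture (weylW α f), puncture_weylW_mem_deltaSubmodule hα ha f.contDiff
        fun _ hx => eq_zero_of_supportedIn f hx⟩
      map_add' := fun f g => Subtype.ext
        (puncture_weylW_add hα (isTestOffZero_supportedIn f) (isTestOffZero_supportedIn g))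
      map_smul' := fun c f => Subtype.ext (puncture_weylW_smul hα c f) }
    ⟨fun f g h => DFunLike.coe_injective (eq_of_puncture_weylW_eq hα (isTestOffZero_supportedIn f)
        (isTestOffZero_supportedIn g) f.continuous g.continuous (congrArg Subtype.val h)),
      fun g => by
        obtain ⟨f, hf, hfa, hfg⟩ := exists_weylW_eq hα ha g.2
        refine ⟨⟨f, hf, fun x hx => hfa x (not_le.mp fun h => hx (abs_le.mp h))⟩, Subtype.ext hfg⟩⟩

/-- The Weyl integral as a linear isomorphism of `𝓓(ℝ)` onto `Δ_α`. -/
def weylEquiv {α : ℝ} (hα : -(1 / 2) < α) :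
    𝓓((⊤ : TopologicalSpace.Opens ℝ), 𝕜) ≃ₗ[𝕜] Delta 𝕜 α :=
  LinearEquiv.ofBijective
    ({ toFun := fun f => ⟨puncture (weylW α f), by
        obtain ⟨a, ha, hfa⟩ := exists_testFunction_bound f
        exact ⟨a, ha, puncture_weylW_mem_deltaSubmodule hα ha f.contDiff hfa⟩⟩
       map_add' := fun f g => Subtype.ext
        (puncture_weylW_add hα (isTestOffZero_testFunction f) (isTestOffZero_testFunction g))
       map_smul' := fun c f => Subtype.ext (puncture_weylW_smul hα c f) } :
      𝓓((⊤ : TopologicalSpace.Opens ℝ), 𝕜) →ₗ[𝕜] Delta 𝕜 α)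
    ⟨fun f g h => DFunLike.coe_injective (eq_of_puncture_weylW_eq hα (isTestOffZero_testFunction f)
        (isTestOffZero_testFunction g) f.continuous g.continuous (congrArg Subtype.val h)),
      fun g => by
        obtain ⟨a, ha, hg⟩ := g.2
        obtain ⟨f, hf, hfa, hfg⟩ := exists_weylW_eq hα ha hg
        have hc : HasCompactSupport f := HasCompactSupport.intro (isCompact_Icc (a := -a) (b := a))
          fun x hx => hfa x (not_le.mp fun h => hx (abs_le.mp h))
        exact ⟨⟨f, hf, hc, fun _ _ => trivial⟩, Subtype.ext hfg⟩⟩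

theorem weylV_puncture_weylW {α : ℝ} (hα : -(1 / 2) < α) {f : ℝ → 𝕜} (hf : IsTestOffZero f) {x : ℝ}
    (hx : x ≠ 0) : weylV α (puncture (weylW α f)) x = f x := by
  rw [weylV_eq_core α _ hx, core_puncture_weylW hα hf hx, inv_smul_smul₀ (transConst_ne_zero hα)]

/-! ### Continuity between `𝓓_a(ℝ)` and `Δ_{a,α}` -/

/-- Under `W_α`, the seminorms of `Δ_{a,α}` become, up to the factor `|transConst α|`, those of
`𝓓_a(ℝ)`. -/
theorem iteratedDeriv_core_weylW {α : ℝ} (hα : -(1 / 2) < α) {f : ℝ → 𝕜} (hf : ContDiff ℝ ∞ f)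
    (hf' : IsTestOffZero f) (p : ℕ) {x : ℝ} (hx : x ≠ 0) :
    iteratedDeriv p (core α (puncture (weylW α f))) x = transConst α • iteratedDeriv p f x := by
  rw [iteratedDeriv_core (φ := transConst α • f)
    (fun y hy => core_puncture_weylW hα hf' hy) p hx]
  have hp : (p : WithTop ℕ∞) ≤ ∞ := by exact_mod_cast le_top
  exact iteratedDeriv_const_smul (hf.contDiffAt.of_le hp) _

theorem continuous_weylEquivIn {α : ℝ} (hα : -(1 / 2) < α) {a : ℝ} (ha : 0 ≤ a) :
    Continuous (weylEquivIn (𝕜 := 𝕜) hα ha) := by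
  refine WithSeminorms.continuous_of_isBounded
    (ContDiffMapSupportedIn.withSeminorms' 𝕜 ℝ 𝕜 ⊤ (symmIcc a)) (DeltaIn.withSeminorms 𝕜 a α)
    (weylEquivIn (𝕜 := 𝕜) hα ha).toLinearMap
    (Seminorm.IsBounded.of_real fun n => ⟨{n}, |transConst α|, fun f => ?_⟩)
  rw [Finset.sup_singleton]
  refine Real.sSup_le ?_ (mul_nonneg (abs_nonneg _) (apply_nonneg _ _))
  rintro s ⟨p, x, hp, -, hx0, rfl⟩
  change ‖iteratedDeriv p (core α (puncture (weylW α f))) x‖ ≤ _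
  rw [iteratedDeriv_core_weylW hα f.contDiff (isTestOffZero_supportedIn f) p hx0, norm_smul,
    Real.norm_eq_abs, ← norm_iteratedFDeriv_eq_norm_iteratedDeriv]
  refine mul_le_mul_of_nonneg_left ?_ (abs_nonneg _)
  refine (ContDiffMapSupportedIn.norm_iteratedFDeriv_apply_le_seminorm_top 𝕜).trans ?_
  exact Seminorm.le_finset_sup_apply (Finset.mem_Iic.mpr hp)

theorem continuous_weylEquivIn_symm {α : ℝ} (hα : -(1 / 2) < α) {a : ℝ} (ha : 0 ≤ a) :
    Continuous (weylEquivIn (𝕜 := 𝕜) hα ha).symm := by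
  refine WithSeminorms.continuous_of_isBounded (DeltaIn.withSeminorms 𝕜 a α)
    (ContDiffMapSupportedIn.withSeminorms 𝕜 ℝ 𝕜 ⊤ (symmIcc a))
    (weylEquivIn (𝕜 := 𝕜) hα ha).symm.toLinearMap
    (Seminorm.IsBounded.of_real fun n => ⟨{n}, |transConst α|⁻¹, fun g => ?_⟩)
  obtain ⟨f, rfl⟩ := (weylEquivIn (𝕜 := 𝕜) hα ha).surjective g
  rw [Finset.sup_singleton]
  change ContDiffMapSupportedIn.seminorm 𝕜 ℝ 𝕜 ⊤ (symmIcc a) n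
    ((weylEquivIn hα ha).symm (weylEquivIn hα ha f)) ≤ |transConst α|⁻¹ *
      DeltaIn.seminorm 𝕜 a α n (weylEquivIn hα ha f)
  rw [LinearEquiv.symm_apply_apply]
  set C := |transConst α|⁻¹ * DeltaIn.seminorm 𝕜 a α n (weylEquivIn hα ha f) with hC
  have hC0 : 0 ≤ C := mul_nonneg (inv_nonneg.mpr (abs_nonneg _)) (apply_nonneg _ _)
  have hne : ∀ x ∈ ({0}ᶜ : Set ℝ), ‖iteratedFDeriv ℝ n f x‖ ≤ C := by
    intro x hx
    by_cases hxa : x ∈ Icc (-a) a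
    · have h1 : ‖iteratedDeriv n (core α (puncture (weylW α f))) x‖ ≤
          DeltaIn.seminorm 𝕜 a α n (weylEquivIn hα ha f) :=
        le_csSup (bddAbove_seminormSet n (weylEquivIn hα ha f).2) ⟨n, x, le_rfl, hxa, hx, rfl⟩
      rw [iteratedDeriv_core_weylW hα f.contDiff (isTestOffZero_supportedIn f) n hx, norm_smul,
        Real.norm_eq_abs] at h1
      rw [norm_iteratedFDeriv_eq_norm_iteratedDeriv, hC, inv_mul_eq_div,
        le_div_iff₀' (abs_pos.mpr (transConst_ne_zero hα))]
      exact h1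
    · rw [f.iteratedFDeriv_zero_on_compl hxa]
      simpa using hC0
  -- The seminorms of `Δ_{a,α}` do not see the origin, which is recovered by density.
  refine (ContDiffMapSupportedIn.seminorm_top_le_iff 𝕜 hC0 n f).2 fun x _ => ?_
  have hclosed : IsClosed {x : ℝ | ‖iteratedFDeriv ℝ n f x‖ ≤ C} :=
    isClosed_le (f.contDiff.continuous_iteratedFDeriv (by exact_mod_cast le_top)).norm
      continuous_const
  exact hclosed.closure_subset_iff.2 hne (dense_compl_singleton (0 : ℝ) x)

/-! ### The inductive limit topologies -/

instance (α : ℝ) : IsTopologicalAddGroup (Delta 𝕜 α) :=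
  topologicalAddGroup_sInf fun _ ht => ht.2.1

instance (α : ℝ) : ContinuousSMul 𝕜 (Delta 𝕜 α) :=
  continuousSMul_sInf fun _ ht => ht.2.2.1

instance (α : ℝ) : LocallyConvexSpace ℝ (Delta 𝕜 α) :=
  .sInf fun _ ht => ht.2.2.2

instance (α : ℝ) : IsScalarTower ℝ 𝕜 (Delta 𝕜 α) :=
  inferInstanceAs (IsScalarTower ℝ 𝕜 (deltaUnion 𝕜 α))

instance (α : ℝ) : ContinuousSMul ℝ (Delta 𝕜 α) :=
  IsScalarTower.continuousSMul (M := ℝ) 𝕜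

theorem continuous_incl {a : ℝ} (ha : 0 ≤ a) (α : ℝ) : Continuous (DeltaIn.incl 𝕜 ha α) :=
  continuous_sInf_rng.2 fun _ ht => ht.1 a ha

/-- Scalar multiplication on `𝓓(ℝ)` is continuous over `ℂ` as well: complex scalars act through
real ones and the multiplication by `i`. -/
theorem continuousSMul_testFunction :
    ContinuousSMul 𝕜 𝓓((⊤ : TopologicalSpace.Opens ℝ), 𝕜) := by
  constructor
  let J : 𝓓((⊤ : TopologicalSpace.Opens ℝ), 𝕜) →L[ℝ] 𝓓((⊤ : TopologicalSpace.Opens ℝ), 𝕜) :=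
    TestFunction.postcompCLM (ContinuousLinearMap.mul ℝ 𝕜 RCLike.I)
  have h : (fun p : 𝕜 × 𝓓((⊤ : TopologicalSpace.Opens ℝ), 𝕜) => p.1 • p.2) =
      fun p => RCLike.re p.1 • p.2 + RCLike.im p.1 • J p.2 := by
    funext p
    ext x
    change p.1 * p.2 x = RCLike.re p.1 • p.2 x + RCLike.im p.1 • (RCLike.I * p.2 x)
    rw [RCLike.real_smul_eq_coe_mul, RCLike.real_smul_eq_coe_mul]
    conv_lhs => rw [← RCLike.re_add_im p.1]
    ring
  rw [h]
  exact ((RCLike.continuous_re.comp continuous_fst).smul continuous_snd).add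
    ((RCLike.continuous_im.comp continuous_fst).smul (J.continuous.comp continuous_snd))

theorem continuous_weylEquiv {α : ℝ} (hα : -(1 / 2) < α) :
    Continuous (weylEquiv (𝕜 := 𝕜) hα) := by
  refine (TestFunction.continuous_iff_continuous_comp (weylEquiv (𝕜 := 𝕜) hα).toLinearMap).2
    fun K hK => ?_
  obtain ⟨a, ha, hKa⟩ := exists_supportedIn_bound K.isCompact
  have h : (weylEquiv (𝕜 := 𝕜) hα).toLinearMap ∘ TestFunction.ofSupportedIn hK =
      DeltaIn.incl 𝕜 ha α ∘ weylEquivIn hα ha ∘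
        (ContDiffMapSupportedIn.monoCLM 𝕜 : 𝓓_{K}(ℝ, 𝕜) →L[𝕜] 𝓓_{symmIcc a}(ℝ, 𝕜)) := by
    funext f
    refine Subtype.ext ?_
    change puncture (weylW α f) =
      puncture (weylW α (ContDiffMapSupportedIn.monoCLM 𝕜 f : 𝓓_{symmIcc a}(ℝ, 𝕜)))
    rw [ContDiffMapSupportedIn.monoCLM_apply, if_pos ⟨le_rfl, hKa⟩]
  rw [h]
  exact (continuous_incl ha α).comp ((continuous_weylEquivIn hα ha).comp
    (ContinuousLinearMap.continuous _))

theorem continuous_weylEquiv_symm {α : ℝ} (hα : -(1 / 2) < α) :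
    Continuous (weylEquiv (𝕜 := 𝕜) hα).symm := by
  have := continuousSMul_testFunction (𝕜 := 𝕜)
  let e := (weylEquiv (𝕜 := 𝕜) hα).symm.toLinearMap
  -- The topology of `Δ_α` is compared with the one transported from `𝓓(ℝ)`.
  refine continuous_iff_le_induced.2 (sInf_le ⟨fun a ha => ?_, topologicalAddGroup_induced e,
    continuousSMul_induced e, LocallyConvexSpace.induced (e.restrictScalars ℝ)⟩)
  refine continuous_induced_rng.2 ?_
  have h : (weylEquiv (𝕜 := 𝕜) hα).symm ∘ DeltaIn.incl 𝕜 ha α =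
      TestFunction.ofSupportedIn (Ω := ⊤) (fun _ _ => trivial) ∘ (weylEquivIn hα ha).symm := by
    funext g
    obtain ⟨f, rfl⟩ := (weylEquivIn (𝕜 := 𝕜) hα ha).surjective g
    rw [Function.comp_apply, Function.comp_apply, LinearEquiv.symm_apply_apply,
      LinearEquiv.symm_apply_eq]
    rfl
  rw [h]
  exact (TestFunction.continuous_ofSupportedIn _).comp (continuous_weylEquivIn_symm hα ha)

end BesselStruve

end

open BesselStruve in
theorem mainTheorem4 {𝕜 : Type*} [RCLike 𝕜] (α : ℝ) (hα : -(1 / 2) < α) :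
    (∀ a : ℝ, 0 ≤ a → ∃ e : 𝓓_{symmIcc a}(ℝ, 𝕜) ≃L[𝕜] DeltaIn 𝕜 a α,
      (∀ f : 𝓓_{symmIcc a}(ℝ, 𝕜), ∀ y : ℝ, y ≠ 0 → e f y = weylW α f y) ∧
      (∀ g : DeltaIn 𝕜 a α, ∀ x : ℝ, x ≠ 0 → e.symm g x = weylV α g x)) ∧
    (∃ e : 𝓓((⊤ : TopologicalSpace.Opens ℝ), 𝕜) ≃L[𝕜] Delta 𝕜 α,
      (∀ f : 𝓓((⊤ : TopologicalSpace.Opens ℝ), 𝕜), ∀ y : ℝ, y ≠ 0 → e f y = weylW α f y) ∧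
      (∀ g : Delta 𝕜 α, ∀ x : ℝ, x ≠ 0 → e.symm g x = weylV α g x)) := by
  constructor
  · intro a ha
    refine ⟨⟨weylEquivIn hα ha, continuous_weylEquivIn hα ha, continuous_weylEquivIn_symm hα ha⟩,
      fun f y hy => puncture_of_ne _ hy, fun g x hx => ?_⟩
    obtain ⟨f, rfl⟩ := (weylEquivIn (𝕜 := 𝕜) hα ha).surjective g
    change (weylEquivIn hα ha).symm (weylEquivIn hα ha f) x = weylV α (puncture (weylW α f)) x
    rw [LinearEquiv.symm_apply_apply, weylV_puncture_weylW hα (isTestOffZero_supportedIn f) hx]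
  · refine ⟨⟨weylEquiv hα, continuous_weylEquiv hα, continuous_weylEquiv_symm hα⟩,
      fun f y hy => puncture_of_ne _ hy, fun g x hx => ?_⟩
    obtain ⟨f, rfl⟩ := (weylEquiv (𝕜 := 𝕜) hα).surjective g
    change (weylEquiv hα).symm (weylEquiv hα f) x = weylV α (puncture (weylW α f)) x
    rw [LinearEquiv.symm_apply_apply, weylV_puncture_weylW hα (isTestOffZero_testFunction f) hx]
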